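/- **Setting.** Let $\mathcal X,\mathcal Y$ be finite sets, $\mathcal Z$ a set and $f:\mathcal X\times\mathcal Y\to\mathcal Z$ a function; logarithms are to base $2$. A $k$-round deterministic protocol consists of $k$ messages sent alternately by Alice (who holds $x\in\mathcal X$) and Bob (who holds $y\in\mathcal Y$). Each message is a bit string, possibly empty, determined by the sender's input and the previous messages, and after each history of messages the set of possible next messages is prefix-free. At the end one player announces an answer in $\mathcal Z$, determined by that player's input and the transcript. Which player sends the first message and which one announces the answer is fixed in advance, arbitrarily but in the same way for all protocols below. In a private coin randomised protocol each player's messages and answer may also depend on a private random coin with finite range, the two coins being independent of each other and of the inputs. The communication cost is the maximum, over all inputs and coin outcomes, of the total number of bits sent. * $R^k_\delta(f)$ is the minimum cost of a $k$-round private coin protocol which, on every input $(x,y)$, answers $f(x,y)$ with probability at least $1-\delta$ over the coins. * For a probability distribution $\mu$ on $\mathcal X\times\mathcal Y$, $C^k_{\mu,\delta}(f)$ is the minimum cost of a $k$-round deterministic protocol that answers correctly with probability at least $1-\delta$ when $(x,y)\sim\mu$. * $C^k_{[\,],\delta}(f)=\sup_\mu C^k_{\mu,\delta}(f)$ over all product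 distributions $\mu=\mu_{\mathcal X}\times\mu_{\mathcal Y}$. (A minimum over an empty set of protocols is $+\infty$.) The function $f^m:\mathcal X^m\times\mathcal Y^m\to\mathcal Z^m$ is $f^m(x,y)=(f(x_1,y_1),\dots,f(x_m,y_m))$. A probability distribution $\kappa$ on a finite set $K$ *partitions* $\mu$ if $\mu=\sum_{d\in K}\kappa_d\,\mu_d$ for some product distributions $\mu_d$ on $\mathcal X\times\mathcal Y$, and $H(\kappa)=-\sum_{d}\kappa_d\log\kappa_d$. **Theorem (direct sum, $k$ rounds).** Let $m,k$ be positive integers and $\epsilon,\delta>0$. Then for every probability distribution $\mu$ on $\mathcal X\times\mathcal Y$ and every $\kappa$ that partitions $\mu$, $$R^k_\delta(f^m)\;\ge\; m\left(\frac{\epsilon^2}{2k}\,C^k_{\mu,\delta+2\epsilon}(f)-2-H(\kappa)\right),$$ that is, $R^k_\delta(f^m)\ge m\cdot\sup_{\mu,\kappa}\left(\frac{\epsilon^2}{2k}\,C^k_{\mu,\delta+2\epsilon}(f)-2-H(\kappa)\right)$. **Corollary.** For the same $m,k,\epsilon,\delta$, $$R^k_\delta(f^m)\;\ge\; m\left(\frac{\epsilon^2}{2k}\,C^k_{[\,],\delta+2\epsilon}(f)-2\right).$$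 -/

import Mathlib

noncomputable section

/-- The two parties of a communication protocol. -/
inductive Player
  | alice
  | bob
  deriving DecidableEq

namespace Player

/-- The other party. -/
def other : Player → Player
  | alice => bob
  | bob => alice

/-- The party that speaks in round `i` (counted from `0`), when the parties alternate and
`first` speaks in round `0`. -/
def speaker (first : Player) : ℕ → Player
  | 0 => first
  | i + 1 => (speaker first i).other

end Player

/-- The possible histories of a conversation: the list of the messages (bit strings) sent so far,
the oldest one first. -/
abbrev History := List (List Bool)

/-- A deterministic two-party protocol with exactly `k` rounds (messages may be empty, so fewer
rounds are allowed too). The parties speak alternately, `first` sends the first message, and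
the party `out` announces the answer at the end. Each message depends on the speaker's input and on
the history, the answer on the input of `out` and on the full transcript. Messages are
self-delimiting: after every history, the set of messages that a party may send is prefix-free. -/
structure DetProtocol (first out : Player) (k : ℕ) (X Y Z : Type*) where
  msgA : History → X → List Bool
  msgB : History → Y → List Bool
  prefixFreeA : ∀ h x x', msgA h x <+: msgA h x' → msgA h x = msgA h x'
  prefixFreeB : ∀ h y y', msgB h y <+: msgB h y' → msgB h y = msgB h y'
  outA : History → X → Z
  outB : History → Y → Z

namespace DetProtocol

variable {first out : Player} {k : ℕ} {X Y Z : Type*}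

/-- The message sent in round `i` on input `(x, y)`, when the history is `h`. -/
def msg (P : DetProtocol first out k X Y Z) (x : X) (y : Y) (i : ℕ) (h : History) : List Bool :=
  match Player.speaker first i with
  | .alice => P.msgA h x
  | .bob => P.msgB h y

/-- The list of the first `i` messages exchanged on input `(x, y)`. -/
def history (P : DetProtocol first out k X Y Z) (x : X) (y : Y) : ℕ → History
  | 0 => []
  | i + 1 => P.history x y i ++ [P.msg x y i (P.history x y i)]

/-- The transcript of all `k` messages on input `(x, y)`. -/
def transcript (P : DetProtocol first out k X Y Z) (x : X) (y : Y) : History :=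
  P.history x y k

/-- The answer on input `(x, y)`. -/
def answer (P : DetProtocol first out k X Y Z) (x : X) (y : Y) : Z :=
  match out with
  | .alice => P.outA (P.transcript x y) x
  | .bob => P.outB (P.transcript x y) y

/-- Communication cost: the maximum over all inputs of the total number of bits exchanged. -/
def cost [Fintype X] [Fintype Y] (P : DetProtocol first out k X Y Z) : ℕ :=
  Finset.univ.sup fun p : X × Y => (P.transcript p.1 p.2).flatten.length

open Classical in
/-- `P` computes `f` with distributional error `δ` under `μ`: the probability of a correct answer
on a `μ`-random input is at least `1 - δ`. -/
def HasDistError [Fintype X] [Fintype Y] (P : DetProtocol first out k X Y Z) (f : X → Y → Z)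
    (μ : X × Y → ℝ) (δ : ℝ) : Prop :=
  1 - δ ≤ ∑ p : X × Y, if P.answer p.1 p.2 = f p.1 p.2 then μ p else 0

end DetProtocol

/-- A `k`-round private coin randomised protocol: Alice and Bob draw independent private coins from
finite sets, with arbitrary distributions `coinA` and `coinB`, and then follow a deterministic
protocol in which each party's own coin is part of that party's input. -/
structure PrivateCoinProtocol (first out : Player) (k : ℕ) (X Y Z : Type*) where
  nA : ℕ
  nB : ℕ
  coinA : Fin nA → ℝ
  coinB : Fin nB → ℝ
  coinA_mem : coinA ∈ stdSimplex ℝ (Fin nA)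
  coinB_mem : coinB ∈ stdSimplex ℝ (Fin nB)
  det : DetProtocol first out k (X × Fin nA) (Y × Fin nB) Z

namespace PrivateCoinProtocol

variable {first out : Player} {k : ℕ} {X Y Z : Type*}

/-- Communication cost: the maximum of the number of bits exchanged, over all inputs and all
outcomes of the coins. -/
def cost [Fintype X] [Fintype Y] (P : PrivateCoinProtocol first out k X Y Z) : ℕ :=
  P.det.cost

open Classical in
/-- `P` is a `δ`-error protocol for `f`: on every input the answer is correct with probability at
least `1 - δ` over the coins. -/
def HasError (P : PrivateCoinProtocol first out k X Y Z) (f : X → Y → Z) (δ : ℝ) : Prop :=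
  ∀ x y, 1 - δ ≤ ∑ a, ∑ b,
    if P.det.answer (x, a) (y, b) = f x y then P.coinA a * P.coinB b else 0

end PrivateCoinProtocol

section Complexity

variable {X Y Z : Type*} [Fintype X] [Fintype Y]

/-- `R^k_δ(f)`, the `k`-round `δ`-error private coin randomised communication complexity
(`⊤` if there is no such protocol). -/
def randComplexity (first out : Player) (k : ℕ) (δ : ℝ) (f : X → Y → Z) : ℕ∞ :=
  ⨅ (P : PrivateCoinProtocol first out k X Y Z) (_ : P.HasError f δ), (P.cost : ℕ∞)

/-- `C^k_{μ,δ}(f)`, the `k`-round `δ`-error distributional communication complexity under `μ`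
(`⊤` if there is no such protocol). -/
def distComplexity (first out : Player) (k : ℕ) (μ : X × Y → ℝ) (δ : ℝ) (f : X → Y → Z) : ℕ∞ :=
  ⨅ (P : DetProtocol first out k X Y Z) (_ : P.HasDistError f μ δ), (P.cost : ℕ∞)

/-- `μ` is a product probability distribution on `X × Y`. -/
def IsProductDist (μ : X × Y → ℝ) : Prop :=
  ∃ μX ∈ stdSimplex ℝ X, ∃ μY ∈ stdSimplex ℝ Y, ∀ x y, μ (x, y) = μX x * μY y

/-- `C^k_{[],δ}(f)`, the supremum of `C^k_{μ,δ}(f)` over all product distributions `μ`. -/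
def productComplexity (first out : Player) (k : ℕ) (δ : ℝ) (f : X → Y → Z) : ℕ∞ :=
  ⨆ (μ : X × Y → ℝ) (_ : IsProductDist μ), distComplexity first out k μ δ f

/-- The probability distribution `κ` on the finite index set `K` partitions `μ`: `μ` is the convex
combination, with the weights `κ`, of product distributions `ν d`. -/
def Partitions {K : Type*} [Fintype K] (κ : K → ℝ) (μ : X × Y → ℝ) : Prop :=
  κ ∈ stdSimplex ℝ K ∧ ∃ ν : K → X × Y → ℝ,
    (∀ d, IsProductDist (ν d)) ∧ ∀ p, μ p = ∑ d, κ d * ν d p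

end Complexity

/-- Shannon entropy in bits (with the convention `0 log 0 = 0`). -/
def shannonEntropy {K : Type*} [Fintype K] (κ : K → ℝ) : ℝ :=
  -∑ d, κ d * Real.logb 2 (κ d)

/-- `f^m`, that is, `m` independent instances of `f`, all of which have to be solved. -/
def copies {X Y Z : Type*} (f : X → Y → Z) (m : ℕ) (x : Fin m → X) (y : Fin m → Y) : Fin m → Z :=
  fun i => f (x i) (y i)

/-- A complexity (a natural number or `⊤`) as an extended real number. -/
def complexityToEReal (c : ℕ∞) : EReal := ((c : ENNReal) : EReal)

end

/-!
Fix a private coin protocol for `f^m`, an index vector `d` drawn from `κ^m`, and independent inputs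
drawn from the product distributions indexed by `d`. Given `d` the `m` coordinates are independent,
so the amounts of information that the transcript carries about the single coordinates add up to at
most the number of bits sent, and for some coordinate `i` it is at most the `m`-th part of the
cost. Feeding a `μ`-random instance into coordinate `i`, and sampling the other ones privately,
solves one instance of `f`. Here the index of coordinate `i` stays hidden, which adds at most
`H(κ)` to the divergence of the transcript from a prior known to both players.

Such a protocol is compressed message by message. With public coins the players draw samples from
the prior of the next message, and the sender transmits the position of the first one that passes a
rejection test; the expected code length is `O(divergence + 1)`, and by the chain rule the
divergences of the rounds add up to that of the transcript. Averaging over the public coins makes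
the protocol deterministic, and Markov's inequality turns expected length into worst case length.
-/

noncomputable section

/-! ### Protocols -/

namespace Player

lemma speaker_other (first : Player) (i : ℕ) :
    speaker first.other i = speaker first (i + 1) := by
  induction i with
  | zero => rfl
  | succ i ih => rw [speaker, ih]; rfl

lemma other_other (p : Player) : p.other.other = p := by cases p <;> rfl

end Player

namespace DetProtocol

variable {first out : Player} {k : ℕ} {X Y Z : Type*}

/-- The number of bits exchanged on input `(x, y)`. -/
def bits (P : DetProtocol first out k X Y Z) (x : X) (y : Y) : ℕ :=
  (P.transcript x y).flatten.length

/-- The protocol that remains after the first message `m`, so that an induction on the number of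
rounds may peel off one round. -/
def tail (P : DetProtocol first out (k + 1) X Y Z) (m : List Bool) :
    DetProtocol first.other out k X Y Z where
  msgA h x := P.msgA (m :: h) x
  msgB h y := P.msgB (m :: h) y
  prefixFreeA h x x' := P.prefixFreeA (m :: h) x x'
  prefixFreeB h y y' := P.prefixFreeB (m :: h) y y'
  outA h x := P.outA (m :: h) x
  outB h y := P.outB (m :: h) y

lemma tail_msg (P : DetProtocol first out (k + 1) X Y Z) (m : List Bool) (x : X) (y : Y) (i : ℕ)
    (h : History) : (P.tail m).msg x y i h = P.msg x y (i + 1) (m :: h) := by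
  unfold msg
  rw [Player.speaker_other]
  rfl

lemma history_succ_eq_cons (P : DetProtocol first out (k + 1) X Y Z) (x : X) (y : Y) (i : ℕ) :
    P.history x y (i + 1) =
      P.msg x y 0 [] :: (P.tail (P.msg x y 0 [])).history x y i := by
  induction i with
  | zero => rfl
  | succ i ih =>
    rw [history, ih, history, tail_msg]
    rfl

lemma transcript_eq_cons (P : DetProtocol first out (k + 1) X Y Z) (x : X) (y : Y) :
    P.transcript x y = P.msg x y 0 [] :: (P.tail (P.msg x y 0 [])).transcript x y :=
  P.history_succ_eq_cons x y k

lemma answer_eq_tail (P : DetProtocol first out (k + 1) X Y Z) (x : X) (y : Y) :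
    P.answer x y = (P.tail (P.msg x y 0 [])).answer x y := by
  cases out <;> simp only [answer, transcript_eq_cons] <;> rfl

lemma bits_eq_tail (P : DetProtocol first out (k + 1) X Y Z) (x : X) (y : Y) :
    P.bits x y = (P.msg x y 0 []).length + (P.tail (P.msg x y 0 [])).bits x y := by
  simp [bits, transcript_eq_cons]

/-- Exchange the roles of the two parties. -/
def swap (P : DetProtocol first out k X Y Z) : DetProtocol first.other out.other k Y X Z where
  msgA := P.msgB
  msgB := P.msgA
  prefixFreeA := P.prefixFreeB
  prefixFreeB := P.prefixFreeA
  outA := P.outB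
  outB := P.outA

lemma swap_msg (P : DetProtocol first out k X Y Z) (x : X) (y : Y) (i : ℕ) (h : History) :
    P.swap.msg y x i h = P.msg x y i h := by
  unfold msg
  rw [Player.speaker_other, Player.speaker]
  cases Player.speaker first i <;> rfl

lemma swap_history (P : DetProtocol first out k X Y Z) (x : X) (y : Y) (i : ℕ) :
    P.swap.history y x i = P.history x y i := by
  induction i with
  | zero => rfl
  | succ i ih => rw [history, history, ih, swap_msg]

lemma swap_transcript (P : DetProtocol first out k X Y Z) (x : X) (y : Y) :
    P.swap.transcript y x = P.transcript x y := P.swap_history x y k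

lemma swap_answer (P : DetProtocol first out k X Y Z) (x : X) (y : Y) :
    P.swap.answer y x = P.answer x y := by
  have h := P.swap_transcript x y
  cases out
  · exact congrArg (fun t => P.outA t x) h
  · exact congrArg (fun t => P.outB t y) h

lemma swap_bits (P : DetProtocol first out k X Y Z) (x : X) (y : Y) :
    P.swap.bits y x = P.bits x y := by
  rw [bits, bits, swap_transcript]

/-- Reinterpret the inputs and the answer of a protocol. -/
def comap {X' Y' Z' : Type*} (P : DetProtocol first out k X Y Z) (φ : X' → X) (ψ : Y' → Y)
    (ζ : Z → Z') : DetProtocol first out k X' Y' Z' where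
  msgA h x := P.msgA h (φ x)
  msgB h y := P.msgB h (ψ y)
  prefixFreeA h x x' := P.prefixFreeA h (φ x) (φ x')
  prefixFreeB h y y' := P.prefixFreeB h (ψ y) (ψ y')
  outA h x := ζ (P.outA h (φ x))
  outB h y := ζ (P.outB h (ψ y))

section comap

variable {X' Y' Z' : Type*} (P : DetProtocol first out k X Y Z) (φ : X' → X) (ψ : Y' → Y)
    (ζ : Z → Z') (x : X') (y : Y')

lemma comap_history (i : ℕ) :
    (P.comap φ ψ ζ).history x y i = P.history (φ x) (ψ y) i := by
  induction i with
  | zero => rfl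
  | succ i ih =>
    rw [history, history, ih]
    rfl

lemma comap_transcript : (P.comap φ ψ ζ).transcript x y = P.transcript (φ x) (ψ y) :=
  P.comap_history φ ψ ζ x y k

lemma comap_answer : (P.comap φ ψ ζ).answer x y = ζ (P.answer (φ x) (ψ y)) := by
  cases out <;> simp only [answer, comap_transcript] <;> rfl

end comap

/-- The protocol without communication in which the answer depends on the input alone. -/
def silent (first out : Player) (k : ℕ) (a : X → Z) (b : Y → Z) :
    DetProtocol first out k X Y Z where
  msgA _ _ := []
  msgB _ _ := []
  prefixFreeA _ _ _ _ := rfl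
  prefixFreeB _ _ _ _ := rfl
  outA _ := a
  outB _ := b

lemma silent_bits (a : X → Z) (b : Y → Z) (x : X) (y : Y) :
    (silent first out k a b).bits x y = 0 := by
  have : ∀ i, ((silent first out k a b).history x y i).flatten = [] := by
    intro i
    induction i with
    | zero => rfl
    | succ i ih =>
      have hm : ∀ h, (silent first out k a b).msg x y i h = [] := by
        intro h; unfold msg; cases Player.speaker first i <;> rfl
      simp [history, ih, hm]
  simp [bits, transcript, this]

/-- Alice first sends the codeword of `e x`, and then the parties continue with the protocol
attached to that value. -/
def prependAlice {J : Type*} [Nonempty J] (code : J → List Bool)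
    (hcode : ∀ i j, code i <+: code j → i = j) (e : X → J)
    (Q : J → DetProtocol (Player.other .alice) out k X Y Z) :
    DetProtocol .alice out (k + 1) X Y Z where
  msgA h x := match h with
    | [] => code (e x)
    | c :: h => (Q (Function.invFun code c)).msgA h x
  msgB h y := match h with
    | [] => []
    | c :: h => (Q (Function.invFun code c)).msgB h y
  prefixFreeA h x x' := match h with
    | [] => fun hp => by rw [hcode _ _ hp]
    | c :: h => (Q (Function.invFun code c)).prefixFreeA h x x'
  prefixFreeB h y y' := match h with
    | [] => fun _ => rfl
    | c :: h => (Q (Function.invFun code c)).prefixFreeB h y y'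
  outA h x := match h with
    | [] => (Q (Function.invFun code [])).outA [] x
    | c :: h => (Q (Function.invFun code c)).outA h x
  outB h y := match h with
    | [] => (Q (Function.invFun code [])).outB [] y
    | c :: h => (Q (Function.invFun code c)).outB h y

section prependAlice

variable {J : Type*} [Nonempty J] (code : J → List Bool)
    (hcode : ∀ i j, code i <+: code j → i = j) (e : X → J)
    (Q : J → DetProtocol (Player.other .alice) out k X Y Z)

lemma prependAlice_tail (j : J) : (prependAlice code hcode e Q).tail (code j) = Q j := by
  have hinj : Function.Injective code := fun i j h => hcode i j (h ▸ List.prefix_rfl)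
  have h1 : (prependAlice code hcode e Q).tail (code j) = Q (Function.invFun code (code j)) := rfl
  rw [h1, Function.leftInverse_invFun hinj j]

lemma prependAlice_msg (x : X) (y : Y) :
    (prependAlice code hcode e Q).msg x y 0 [] = code (e x) := rfl

lemma prependAlice_answer (x : X) (y : Y) :
    (prependAlice code hcode e Q).answer x y = (Q (e x)).answer x y := by
  rw [answer_eq_tail, prependAlice_msg, prependAlice_tail]

lemma prependAlice_bits (x : X) (y : Y) :
    (prependAlice code hcode e Q).bits x y = (code (e x)).length + (Q (e x)).bits x y := by
  rw [bits_eq_tail, prependAlice_msg, prependAlice_tail]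

end prependAlice

lemma prefix_of_take_prefix_take {u v : List Bool} (huv : u <+: v → u = v) (n : ℕ)
    (h : u.take n <+: v.take n) : u.take n = v.take n := by
  rcases le_or_gt u.length n with hu | hu
  · have h1 : u.take n = u := List.take_of_length_le hu
    rw [h1] at h ⊢
    have := huv (h.trans (List.take_prefix n v))
    rw [← this, h1]
  · refine h.eq_of_length_le ?_
    simp [List.length_take, hu.le]

/-- Messages are cut off as soon as `B` bits have been exchanged. -/
def truncate (P : DetProtocol first out k X Y Z) (B : ℕ) : DetProtocol first out k X Y Z where
  msgA h x := (P.msgA h x).take (B - h.flatten.length)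
  msgB h y := (P.msgB h y).take (B - h.flatten.length)
  prefixFreeA h x x' := prefix_of_take_prefix_take (P.prefixFreeA h x x') _
  prefixFreeB h y y' := prefix_of_take_prefix_take (P.prefixFreeB h y y') _
  outA := P.outA
  outB := P.outB

lemma truncate_msg (P : DetProtocol first out k X Y Z) (B : ℕ) (x : X) (y : Y) (i : ℕ)
    (h : History) :
    (P.truncate B).msg x y i h = (P.msg x y i h).take (B - h.flatten.length) := by
  unfold msg
  cases Player.speaker first i <;> rfl

lemma truncate_bits_le (P : DetProtocol first out k X Y Z) (B : ℕ) (x : X) (y : Y) :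
    (P.truncate B).bits x y ≤ B := by
  have : ∀ i, ((P.truncate B).history x y i).flatten.length ≤ B := by
    intro i
    induction i with
    | zero => simp [history]
    | succ i ih =>
      rw [history, truncate_msg]
      simp only [List.flatten_append, List.flatten_cons, List.flatten_nil, List.append_nil,
        List.length_append, List.length_take]
      omega
  exact this k

lemma history_prefix (P : DetProtocol first out k X Y Z) (x : X) (y : Y) {i j : ℕ} (hij : i ≤ j) :
    P.history x y i <+: P.history x y j := by
  induction j, hij using Nat.le_induction with
  | base => exact List.prefix_rfl
  | succ j _ ih => exact ih.trans (List.prefix_append _ _)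

lemma truncate_history (P : DetProtocol first out k X Y Z) {B : ℕ} {x : X} {y : Y}
    (hB : P.bits x y ≤ B) {i : ℕ} (hi : i ≤ k) :
    (P.truncate B).history x y i = P.history x y i := by
  induction i with
  | zero => rfl
  | succ i ih =>
    have hlen := (P.history_prefix x y hi).flatten.length_le.trans hB
    rw [history, history, ih (by omega), truncate_msg, List.take_of_length_le]
    rw [history] at hlen
    simp only [List.flatten_append, List.flatten_cons, List.flatten_nil, List.append_nil,
        List.length_append] at hlen
    omega

lemma truncate_answer (P : DetProtocol first out k X Y Z) {B : ℕ} {x : X} {y : Y}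
    (hB : P.bits x y ≤ B) : (P.truncate B).answer x y = P.answer x y := by
  have h : (P.truncate B).transcript x y = P.transcript x y := P.truncate_history hB le_rfl
  cases out <;> simp only [answer, h] <;> rfl

lemma length_history (P : DetProtocol first out k X Y Z) (x : X) (y : Y) (i : ℕ) :
    (P.history x y i).length = i := by
  induction i with
  | zero => rfl
  | succ i ih => simp [history, ih]

lemma length_transcript (P : DetProtocol first out k X Y Z) (x : X) (y : Y) :
    (P.transcript x y).length = k := P.length_history x y k

lemma msg_eq_of_prefix_or_prefix (P : DetProtocol first out k X Y Z) {x x' : X} {y y' : Y} {i : ℕ}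
    {h : History} (hp : P.msg x y i h <+: P.msg x' y' i h ∨ P.msg x' y' i h <+: P.msg x y i h) :
    P.msg x y i h = P.msg x' y' i h := by
  unfold msg at hp ⊢
  cases hs : Player.speaker first i <;> simp only [hs] at hp ⊢
  · exact hp.elim (P.prefixFreeA _ _ _) fun hp => (P.prefixFreeA _ _ _ hp).symm
  · exact hp.elim (P.prefixFreeB _ _ _) fun hp => (P.prefixFreeB _ _ _ hp).symm

lemma history_eq_of_prefix (P : DetProtocol first out k X Y Z) {x x' : X} {y y' : Y}
    {l : List Bool} (h : (P.transcript x y).flatten <+: l)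
    (h' : (P.transcript x' y').flatten <+: l) {i : ℕ} (hi : i ≤ k) :
    P.history x y i = P.history x' y' i := by
  induction i with
  | zero => rfl
  | succ i ih =>
    have heq := ih (by omega)
    have hpre := (P.history_prefix x y hi).flatten.trans h
    have hpre' := (P.history_prefix x' y' hi).flatten.trans h'
    rw [history, heq] at hpre
    rw [history] at hpre'
    simp only [List.flatten_append, List.flatten_cons, List.flatten_nil, List.append_nil]
      at hpre hpre'
    have hmsg := List.prefix_or_prefix_of_prefix hpre hpre'
    simp only [List.prefix_append_right_inj] at hmsg
    rw [history, history, heq, P.msg_eq_of_prefix_or_prefix hmsg]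

lemma bits_le_cost [Fintype X] [Fintype Y] (P : DetProtocol first out k X Y Z) (x : X) (y : Y) :
    P.bits x y ≤ P.cost :=
  Finset.le_sup (f := fun p : X × Y => (P.transcript p.1 p.2).flatten.length)
    (Finset.mem_univ (x, y))

lemma card_transcripts_le [Fintype X] [Fintype Y] (P : DetProtocol first out k X Y Z) :
    (Finset.univ.image fun p : X × Y => P.transcript p.1 p.2).card ≤ 2 ^ P.cost := by
  let pad : History → List.Vector Bool P.cost := fun t =>
    ⟨(t.flatten ++ List.replicate P.cost false).take P.cost, by simp⟩
  have hcard : Fintype.card (List.Vector Bool P.cost) = 2 ^ P.cost := by simp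
  rw [← hcard, ← Finset.card_univ]
  refine Finset.card_le_card_of_injOn pad (fun _ _ => Finset.mem_coe.2 (Finset.mem_univ _)) ?_
  intro t ht t' ht' htt
  simp only [Finset.coe_image, Finset.coe_univ, Set.image_univ, Set.mem_range, Prod.exists]
    at ht ht'
  obtain ⟨x, y, rfl⟩ := ht
  obtain ⟨x', y', rfl⟩ := ht'
  have key : ∀ x y, (P.transcript x y).flatten <+: (pad (P.transcript x y)).1 := by
    intro x y
    have := P.bits_le_cost x y
    exact List.prefix_take_iff.2 ⟨List.prefix_append _ _, this⟩
  refine P.history_eq_of_prefix (key x y) ?_ le_rfl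
  rw [htt]
  exact key x' y'

end DetProtocol

/-! ### Universal codes and sampling -/

section ProductWeights

variable {ι M R : Type*} [Fintype ι] [DecidableEq ι] [CommSemiring R]

lemma prod_update_update_mul (g : ι → M → R) (i : ι) (c : M → R) (ω : ι → M) (m : M) :
    (∏ j, Function.update g i c j (Function.update ω i m j)) * g i (ω i) =
      (∏ j, g j (ω j)) * c m := by
  have hrest : ∏ j ∈ Finset.univ.erase i, Function.update g i c j (Function.update ω i m j) =
      ∏ j ∈ Finset.univ.erase i, g j (ω j) :=
    Finset.prod_congr rfl fun j hj => by
      rw [Function.update_of_ne (Finset.ne_of_mem_erase hj),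
        Function.update_of_ne (Finset.ne_of_mem_erase hj)]
  rw [← Finset.mul_prod_erase Finset.univ (fun j => g j (ω j)) (Finset.mem_univ i),
    ← Finset.mul_prod_erase Finset.univ
      (fun j => Function.update g i c j (Function.update ω i m j)) (Finset.mem_univ i),
    hrest, Function.update_self, Function.update_self]
  ring

variable [Fintype M]

lemma sum_prod_pi_eq_one {g : ι → M → R} (hg : ∀ i, ∑ m, g i m = 1) :
    ∑ ω : ι → M, ∏ i, g i (ω i) = 1 := by
  rw [← Fintype.piFinset_univ, ← Finset.prod_univ_sum]
  exact Finset.prod_eq_one fun i _ => hg i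

lemma sum_prod_pi_resample (g : ι → M → R) (i : ι) (hg : ∑ m, g i m = 1) (c : M → R)
    (G : (ι → M) → R) :
    ∑ ω : ι → M, (∏ j, g j (ω j)) * ∑ m, c m * G (Function.update ω i m) =
      ∑ ω : ι → M, (∏ j, Function.update g i c j (ω j)) * G ω := by
  let exchange : (ι → M) × M ≃ (ι → M) × M :=
    { toFun := fun p => (Function.update p.1 i p.2, p.1 i)
      invFun := fun p => (Function.update p.1 i p.2, p.1 i)
      left_inv := fun p => by simp
      right_inv := fun p => by simp }
  calc _ = ∑ p : (ι → M) × M, (∏ j, g j (p.1 j)) * c p.2 * G (Function.update p.1 i p.2) := by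
        rw [Fintype.sum_prod_type]
        simp only [Finset.mul_sum, mul_assoc]
    _ = ∑ p : (ι → M) × M, (∏ j, Function.update g i c j (p.1 j)) * g i p.2 * G p.1 := by
        refine Fintype.sum_equiv exchange _ _ fun p => ?_
        simp only [exchange, Equiv.coe_fn_mk, prod_update_update_mul]
    _ = _ := by
        rw [Fintype.sum_prod_type]
        refine Finset.sum_congr rfl fun ω _ => ?_
        simp only [mul_right_comm _ (g i _)]
        rw [← Finset.mul_sum, hg, mul_one]

lemma sum_prod_pi_update (g : ι → M → R) (i : ι) (hg : ∑ m, g i m = 1) (G : (ι → M) → R) :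
    ∑ ω : ι → M, (∏ j, g j (ω j)) * ∑ m, g i m * G (Function.update ω i m) =
      ∑ ω : ι → M, (∏ j, g j (ω j)) * G ω := by
  rw [sum_prod_pi_resample g i hg, Function.update_eq_self]

lemma sum_prod_pi_apply (g : ι → M → R) (hg : ∀ i, ∑ m, g i m = 1) (i : ι) (G : M → R) :
    ∑ ω : ι → M, (∏ j, g j (ω j)) * G (ω i) = ∑ m, g i m * G m := by
  rw [← sum_prod_pi_update g i (hg i) fun ω => G (ω i)]
  simp only [Function.update_self]
  rw [← Finset.sum_mul, sum_prod_pi_eq_one hg, one_mul]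

end ProductWeights

lemma sum_mul_div_sum_fiber_le {ι J : Type*} [Fintype ι] [DecidableEq J] (T : ι → J) (w : ι → ℝ)
    {r : J → ℝ} (hr : ∀ t, 0 ≤ r t) :
    ∑ i, w i * (r (T i) / ∑ i', if T i' = T i then w i' else 0) ≤
      ∑ t ∈ Finset.univ.image T, r t := by
  rw [← Finset.sum_fiberwise_of_maps_to (s := Finset.univ) (t := Finset.univ.image T) (g := T)
    fun i _ => Finset.mem_image_of_mem _ (Finset.mem_univ i)]
  refine Finset.sum_le_sum fun t _ => ?_
  set W := ∑ i', if T i' = t then w i' else 0 with hW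
  calc _ = ∑ i with T i = t, w i * (r t / W) :=
        Finset.sum_congr rfl fun i hi => by rw [(Finset.mem_filter.1 hi).2]
    _ = W * W⁻¹ * r t := by
        rw [← Finset.sum_mul, Finset.sum_filter, ← hW]
        ring
    _ ≤ r t := mul_le_of_le_one_left (hr t) mul_inv_le_one

section Logarithms

lemma logb_two_le_self {u : ℝ} (hu : 0 < u) : Real.logb 2 u ≤ u := by
  have h := Real.log_le_sub_one_of_pos (half_pos hu)
  rw [Real.log_div hu.ne' two_ne_zero] at h
  rw [Real.logb, div_le_iff₀ (Real.log_pos one_lt_two)]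
  nlinarith [Real.log_two_gt_d9, Real.log_two_lt_d9]

lemma sum_mul_logb_nonpos {ι : Type*} [Fintype ι] {b : ℝ} (hb : 1 < b) {w u : ι → ℝ}
    (hw : ∀ i, 0 ≤ w i) (hu : ∀ i, 0 < w i → 0 < u i) (h : ∑ i, w i * u i ≤ ∑ i, w i) :
    ∑ i, w i * Real.logb b (u i) ≤ 0 := by
  have hlog : ∑ i, w i * Real.log (u i) ≤ ∑ i, (w i * u i - w i) := by
    refine Finset.sum_le_sum fun i _ => ?_
    rcases (hw i).eq_or_lt with hi | hi
    · simp [← hi]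
    · rw [← mul_sub_one]
      exact mul_le_mul_of_nonneg_left (Real.log_le_sub_one_of_pos (hu i hi)) hi.le
  rw [Finset.sum_sub_distrib] at hlog
  simp only [Real.logb, ← mul_div_assoc, ← Finset.sum_div]
  exact div_nonpos_of_nonpos_of_nonneg (by linarith) (Real.log_pos hb).le

/-- The relative entropy (Kullback–Leibler divergence) of `p` from `q`, in bits. It is meaningful
only if `p` vanishes wherever `q` does, since `p m / 0 = 0`. -/
def relEntropy {M : Type*} [Fintype M] (p q : M → ℝ) : ℝ :=
  ∑ m, p m * Real.logb 2 (p m / q m)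

end Logarithms

section IndexCode

/-- A self-delimiting code of the positive integers: every binary digit of `n` below the leading
one is preceded by a continuation bit. -/
def posCode (n : ℕ) : List Bool :=
  if h : n ≤ 1 then [false] else true :: (n % 2 == 1) :: posCode (n / 2)
termination_by n
decreasing_by omega

lemma posCode_prefix {i j : ℕ} (hi : 1 ≤ i) (hj : 1 ≤ j) (h : posCode i <+: posCode j) :
    i = j := by
  induction i using Nat.strong_induction_on generalizing j with
  | _ i ih =>
    rw [posCode, posCode.eq_def j] at h
    split_ifs at h with hi1 hj1 hj1
    · omega
    · simp [List.cons_prefix_cons] at h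
    · simp [List.cons_prefix_cons] at h
    · simp only [List.cons_prefix_cons, true_and] at h
      have hdiv := ih (i / 2) (by omega) (by omega) (by omega) h.2
      have hmod : i % 2 = 1 ↔ j % 2 = 1 := by simpa using h.1
      omega

lemma length_posCode {n : ℕ} (hn : 1 ≤ n) : (posCode n).length = 2 * Nat.log 2 n + 1 := by
  induction n using Nat.strong_induction_on with
  | _ n ih =>
    rw [posCode]
    split_ifs with h1
    · obtain rfl : n = 1 := by omega
      simp
    · rw [List.length_cons, List.length_cons, ih (n / 2) (by omega) (by omega),
        Nat.log_of_one_lt_of_le one_lt_two (by omega : 2 ≤ n)]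
      ring

/-- A self-delimiting code of indices, with one more codeword for failure. -/
def indexCode {N : ℕ} : Option (Fin N) → List Bool
  | none => [false]
  | some j => true :: posCode (j + 1)

lemma indexCode_prefix {N : ℕ} (i j : Option (Fin N)) (h : indexCode i <+: indexCode j) :
    i = j := by
  cases i <;> cases j <;> simp only [indexCode, List.cons_prefix_cons, false_and,
    true_and, Bool.false_eq_true, Bool.true_eq_false] at h ⊢
  have := posCode_prefix (by omega) (by omega) h
  simp only [Option.some.injEq]
  ext
  omega

lemma length_indexCode_some_le {N : ℕ} (j : Fin N) :
    ((indexCode (some j)).length : ℝ) ≤ 2 * Real.logb 2 (j + 1) + 2 := by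
  rw [indexCode, List.length_cons, length_posCode (by omega)]
  have h := Real.natLog_le_logb (j + 1) 2
  push_cast at h ⊢
  linarith

end IndexCode

section FirstAccept

lemma sum_geometric_mul_succ (A : ℝ) (N : ℕ) :
    ∑ j : Fin N, (1 - A) ^ (j : ℕ) * A * ((j + 1) * A) = 1 - (1 + N * A) * (1 - A) ^ N := by
  induction N with
  | zero => simp
  | succ N ih =>
    rw [Fin.sum_univ_castSucc]
    simp only [Fin.val_castSucc, Fin.val_last, ih]
    push_cast
    ring

lemma sum_geometric_mul (A : ℝ) (N : ℕ) :
    ∑ j : Fin N, (1 - A) ^ (j : ℕ) * A = 1 - (1 - A) ^ N := by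
  have h := mul_neg_geom_sum (1 - A) N
  rw [← Finset.sum_mul, Fin.sum_univ_eq_sum_range (fun j => (1 - A) ^ j), ← h]
  ring

lemma sum_geometric_mul_length_indexCode_le {A : ℝ} (hA0 : 0 < A) (hA1 : A ≤ 1) (N : ℕ) :
    ∑ j : Fin N, (1 - A) ^ (j : ℕ) * A * ((indexCode (some j)).length : ℝ) + (1 - A) ^ N ≤
      2 * -Real.logb 2 A + 4 := by
  have hr0 : 0 ≤ 1 - A := sub_nonneg.2 hA1
  have hL : 0 ≤ -Real.logb 2 A := neg_nonneg.2 (Real.logb_nonpos one_lt_two hA0.le hA1)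
  -- `logb 2 (j + 1) = logb 2 ((j + 1) * A) - logb 2 A`, and `(j + 1) * A` is `1` on average.
  have hlen : ∀ j : Fin N, ((indexCode (some j)).length : ℝ) ≤
      2 * -Real.logb 2 A + 2 + 2 * ((j + 1) * A) := by
    intro j
    have hj : (0 : ℝ) < (j : ℕ) + 1 := by positivity
    have h := logb_two_le_self (mul_pos hj hA0)
    rw [Real.logb_mul hj.ne' hA0.ne'] at h
    linarith [length_indexCode_some_le j]
  have hsum : ∑ j : Fin N, (1 - A) ^ (j : ℕ) * A * ((indexCode (some j)).length : ℝ) ≤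
      ∑ j : Fin N, ((2 * -Real.logb 2 A + 2) * ((1 - A) ^ (j : ℕ) * A) +
        2 * ((1 - A) ^ (j : ℕ) * A * ((j + 1) * A))) := by
    refine Finset.sum_le_sum fun j _ => ?_
    have := mul_le_mul_of_nonneg_left (hlen j) (show 0 ≤ (1 - A) ^ (j : ℕ) * A by positivity)
    linarith
  rw [Finset.sum_add_distrib, ← Finset.mul_sum, ← Finset.mul_sum, sum_geometric_mul,
    sum_geometric_mul_succ] at hsum
  have hpow : 0 ≤ (1 - A) ^ N := pow_nonneg hr0 N
  have hNA : 0 ≤ N * A * (1 - A) ^ N := by positivity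
  nlinarith [mul_nonneg hL hpow]

variable {M : Type*} {N : ℕ}

/-- The probability that `o` is the index of the first accepted sample (`none` if there is no such
index), when the samples are `ω` and each sample `m` is accepted with probability `a m`,
independently of the others. -/
def firstAccept (a : M → ℝ) (ω : Fin N → M) : Option (Fin N) → ℝ
  | none => ∏ i, (1 - a (ω i))
  | some j => (∏ i ∈ Finset.Iio j, (1 - a (ω i))) * a (ω j)

variable {a : M → ℝ}

lemma firstAccept_nonneg (ha0 : ∀ m, 0 ≤ a m) (ha1 : ∀ m, a m ≤ 1) (ω : Fin N → M)
    (o : Option (Fin N)) : 0 ≤ firstAccept a ω o := by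
  have hprod : ∀ s : Finset (Fin N), 0 ≤ ∏ i ∈ s, (1 - a (ω i)) := fun s =>
    Finset.prod_nonneg fun i _ => sub_nonneg.2 (ha1 _)
  cases o
  exacts [hprod _, mul_nonneg (hprod _) (ha0 _)]

lemma sum_firstAccept (a : M → ℝ) (ω : Fin N → M) : ∑ o, firstAccept a ω o = 1 := by
  simp only [Fintype.sum_option, firstAccept]
  rw [Finset.prod_one_sub_ordered]
  have : ∀ i : Fin N, Finset.univ.filter (· < i) = Finset.Iio i := fun i => by ext; simp
  simp [this, mul_comm]

variable [Fintype M] {q : M → ℝ}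

lemma sum_prod_mul_firstAccept_none (hq : ∑ m, q m = 1) (a : M → ℝ) (N : ℕ) :
    ∑ ω : Fin N → M, (∏ i, q (ω i)) * firstAccept a ω none = (1 - ∑ m, q m * a m) ^ N := by
  simp only [firstAccept, ← Finset.prod_mul_distrib]
  rw [← Fintype.piFinset_univ,
    ← Finset.prod_univ_sum (fun _ => Finset.univ) fun _ m => q m * (1 - a m)]
  simp [mul_sub, Finset.sum_sub_distrib, hq]

lemma prod_ite_lt_ite_eq {R : Type*} [CommMonoid R] (F : Fin N → R) (c : R) (j : Fin N) :
    ∏ i, (if i < j then F i else if i = j then c else 1) = (∏ i ∈ Finset.Iio j, F i) * c := by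
  rw [Finset.prod_ite]
  congr 1
  · exact Finset.prod_congr (by ext; simp) fun _ _ => rfl
  · rw [Finset.prod_eq_single j (fun b _ hb => if_neg hb) (by simp), if_pos rfl]

lemma sum_prod_mul_firstAccept_some (hq : ∑ m, q m = 1) (a G : M → ℝ) (j : Fin N) :
    ∑ ω : Fin N → M, (∏ i, q (ω i)) * (firstAccept a ω (some j) * G (ω j)) =
      (1 - ∑ m, q m * a m) ^ (j : ℕ) * ∑ m, q m * (a m * G m) := by
  let factor (i : Fin N) (m : M) : ℝ :=
    q m * if i < j then 1 - a m else if i = j then a m * G m else 1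
  have hterm (ω : Fin N → M) :
      (∏ i, q (ω i)) * (firstAccept a ω (some j) * G (ω j)) = ∏ i, factor i (ω i) := by
    rw [firstAccept, mul_assoc, ← prod_ite_lt_ite_eq, ← Finset.prod_mul_distrib]
    refine Finset.prod_congr rfl fun i _ => ?_
    by_cases hij : i = j <;> simp [factor, hij]
  have hsum (i : Fin N) : ∑ m, factor i m =
      if i < j then 1 - ∑ m, q m * a m else if i = j then ∑ m, q m * (a m * G m) else 1 := by
    split_ifs <;> simp [factor, mul_sub, Finset.sum_sub_distrib, *]
  simp only [hterm]
  rw [← Fintype.piFinset_univ, ← Finset.prod_univ_sum (fun _ => Finset.univ) factor]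
  simp only [hsum, prod_ite_lt_ite_eq, Finset.prod_const, Fin.card_Iio]

lemma sum_prod_mul_firstAccept_output (hq : ∑ m, q m = 1) (a G : M → ℝ) (N : ℕ) :
    ∑ ω : Fin N → M, (∏ i, q (ω i)) * ∑ j, firstAccept a ω (some j) * G (ω j) =
      (∑ j : Fin N, (1 - ∑ m, q m * a m) ^ (j : ℕ)) * ∑ m, q m * (a m * G m) := by
  simp only [Finset.mul_sum (s := Finset.univ (α := Fin N))]
  rw [Finset.sum_comm, Finset.sum_mul]
  exact Finset.sum_congr rfl fun j _ => sum_prod_mul_firstAccept_some hq a G j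

lemma sum_prod_mul_firstAccept_length_le (hq : ∑ m, q m = 1) (ha0 : 0 < ∑ m, q m * a m)
    (ha1 : ∑ m, q m * a m ≤ 1) (N : ℕ) :
    ∑ ω : Fin N → M, (∏ i, q (ω i)) * ∑ o, firstAccept a ω o * ((indexCode o).length : ℝ) ≤
      2 * -Real.logb 2 (∑ m, q m * a m) + 4 := by
  refine le_of_eq_of_le ?_ (sum_geometric_mul_length_indexCode_le ha0 ha1 N)
  simp only [Fintype.sum_option, mul_add, Finset.sum_add_distrib]
  rw [add_comm]
  congr 1
  · simp only [Finset.mul_sum (s := Finset.univ (α := Fin N))]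
    rw [Finset.sum_comm]
    refine Finset.sum_congr rfl fun j _ => ?_
    rw [sum_prod_mul_firstAccept_some hq a fun _ => ((indexCode (some j)).length : ℝ)]
    simp only [← mul_assoc, ← Finset.sum_mul]
  · rw [← sum_prod_mul_firstAccept_none hq]
    simp [indexCode]

end FirstAccept

/-! ### Rejection sampling -/

section RejectionSampling

variable {M : Type*} {p q : M → ℝ}

/-- The level of `m`: the likelihood ratio `p m / q m` rounded up to a power of two. -/
def level (p q : M → ℝ) (m : M) : ℕ := ⌈Real.logb 2 (p m / q m)⌉₊

/-- The probability of accepting the sample `m` from `q` when sampling at level `s`. -/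
def accept (p q : M → ℝ) (s : ℕ) (m : M) : ℝ :=
  if level p q m = s then p m / (q m * 2 ^ s) else 0

/-- The probability of level `s` under `p`. -/
def levelMass [Fintype M] (p q : M → ℝ) (s : ℕ) : ℝ := ∑ m, if level p q m = s then p m else 0

lemma accept_nonneg (hp0 : ∀ m, 0 ≤ p m) (hq0 : ∀ m, 0 ≤ q m) (s : ℕ) (m : M) :
    0 ≤ accept p q s m := by
  have := hp0 m
  have := hq0 m
  unfold accept
  split_ifs <;> positivity

lemma accept_le_one (hp0 : ∀ m, 0 ≤ p m) (habs : ∀ m, 0 < p m → 0 < q m) (s : ℕ) (m : M) :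
    accept p q s m ≤ 1 := by
  unfold accept
  split_ifs with hs
  · rcases (hp0 m).eq_or_lt with hp | hp
    · simp [← hp]
    · have hq := habs m hp
      rw [div_le_one (by positivity), mul_comm, ← div_le_iff₀ hq, ← hs, level,
        ← Real.rpow_natCast, ← Real.logb_le_iff_le_rpow one_lt_two (by positivity)]
      exact Nat.le_ceil _
  · exact zero_le_one

lemma mul_accept (hp0 : ∀ m, 0 ≤ p m) (habs : ∀ m, 0 < p m → 0 < q m) (s : ℕ) (m : M) :
    q m * accept p q s m = (if level p q m = s then p m else 0) / 2 ^ s := by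
  unfold accept
  split_ifs
  · rcases (hp0 m).eq_or_lt with hp | hp
    · simp [← hp]
    · have hq := habs m hp
      field_simp
  · simp

lemma level_le {m : M} (hp : 0 < p m) (hq : 0 < q m) :
    (level p q m : ℝ) ≤ Real.logb 2 (p m / q m) + 1 + q m / p m := by
  have hratio : 0 < q m / p m := by positivity
  rcases le_total 0 (Real.logb 2 (p m / q m)) with h | h
  · rw [level]
    linarith [(Nat.ceil_lt_add_one h).le]
  · rw [level, Nat.ceil_eq_zero.2 h, ← inv_div, Real.logb_inv]
    have := logb_two_le_self hratio
    push_cast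
    linarith

variable [Fintype M]

lemma sum_mul_accept (hp0 : ∀ m, 0 ≤ p m) (habs : ∀ m, 0 < p m → 0 < q m) (s : ℕ) :
    ∑ m, q m * accept p q s m = levelMass p q s / 2 ^ s := by
  rw [levelMass, Finset.sum_div]
  exact Finset.sum_congr rfl fun m _ => mul_accept hp0 habs s m

lemma le_levelMass (hp0 : ∀ m, 0 ≤ p m) (m : M) : p m ≤ levelMass p q (level p q m) := by
  have hterm : ∀ m' ∈ Finset.univ, 0 ≤ if level p q m' = level p q m then p m' else 0 := by
    intro m' _
    split_ifs
    exacts [hp0 m', le_rfl]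
  simpa [levelMass] using Finset.single_le_sum hterm (Finset.mem_univ m)

lemma sum_mul_accept_pos (hp0 : ∀ m, 0 ≤ p m) (habs : ∀ m, 0 < p m → 0 < q m) {m : M}
    (hm : 0 < p m) : 0 < ∑ m', q m' * accept p q (level p q m) m' := by
  rw [sum_mul_accept hp0 habs]
  exact div_pos (hm.trans_le (le_levelMass hp0 m)) (by positivity)

lemma sum_mul_accept_le_one (hp0 : ∀ m, 0 ≤ p m) (hq : q ∈ stdSimplex ℝ M)
    (habs : ∀ m, 0 < p m → 0 < q m) (s : ℕ) : ∑ m, q m * accept p q s m ≤ 1 := by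
  rw [← hq.2]
  exact Finset.sum_le_sum fun m _ =>
    mul_le_of_le_one_right (hq.1 m) (accept_le_one hp0 habs s m)

lemma sum_div_levelMass_mul_half_pow_le :
    ∑ m, p m * ((1 / 2 : ℝ) ^ (level p q m + 1) / levelMass p q (level p q m)) ≤ 1 := by
  have hgeom : HasSum (fun s : ℕ => (1 / 2 : ℝ) ^ (s + 1)) 1 := by
    simpa [pow_succ', div_eq_mul_inv] using hasSum_geometric_two' 1
  exact (sum_mul_div_sum_fiber_le (level p q) p (r := fun s => (1 / 2) ^ (s + 1))
    fun s => by positivity).trans (sum_le_hasSum _ (fun _ _ => by positivity) hgeom)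

lemma sum_mul_neg_logb_levelMass_le (hp : p ∈ stdSimplex ℝ M) :
    ∑ m, p m * -Real.logb 2 (levelMass p q (level p q m)) ≤ ∑ m, p m * level p q m + 1 := by
  have hmass : ∀ m, 0 < p m → 0 < levelMass p q (level p q m) := fun m hm =>
    hm.trans_le (le_levelMass hp.1 m)
  have hjensen := sum_mul_logb_nonpos one_lt_two hp.1
    (fun m hm => div_pos (by positivity : (0 : ℝ) < (1 / 2) ^ (level p q m + 1)) (hmass m hm))
    (sum_div_levelMass_mul_half_pow_le.trans hp.2.ge)
  have hterm : ∀ m, p m * -Real.logb 2 (levelMass p q (level p q m)) =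
      p m * level p q m + p m + p m * Real.logb 2
        ((1 / 2) ^ (level p q m + 1) / levelMass p q (level p q m)) := by
    intro m
    rcases (hp.1 m).eq_or_lt with hm | hm
    · simp [← hm]
    · rw [Real.logb_div (by positivity) (hmass m hm).ne', Real.logb_pow, one_div, Real.logb_inv,
        Real.logb_self_eq_one one_lt_two]
      push_cast
      ring
  simp only [hterm, Finset.sum_add_distrib, hp.2]
  linarith

lemma sum_mul_level_le (hp : p ∈ stdSimplex ℝ M) (hq : q ∈ stdSimplex ℝ M)
    (habs : ∀ m, 0 < p m → 0 < q m) : ∑ m, p m * level p q m ≤ relEntropy p q + 2 := by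
  have hterm : ∀ m, p m * level p q m ≤ p m * Real.logb 2 (p m / q m) + p m + q m := by
    intro m
    rcases (hp.1 m).eq_or_lt with hm | hm
    · simp [← hm, hq.1 m]
    · have h := mul_le_mul_of_nonneg_left (level_le hm (habs m hm)) hm.le
      rwa [mul_add, mul_add, mul_div_cancel₀ _ hm.ne', mul_one] at h
  refine (Finset.sum_le_sum fun m _ => hterm m).trans_eq ?_
  rw [Finset.sum_add_distrib, Finset.sum_add_distrib, hp.2, hq.2, relEntropy]
  ring

variable {N : ℕ}

/-- The distribution of the index that a sender with message distribution `p` announces, when the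
public samples, drawn from the prior `q`, are `ω`: the sender draws `m` from `p` and announces the
first sample accepted at the level of `m`. A sample accepted at level `s` is distributed as `p`
conditioned on level `s`, so the announced sample again has distribution `p`, up to failure. -/
def rejectionKernel (p q : M → ℝ) (ω : Fin N → M) (o : Option (Fin N)) : ℝ :=
  ∑ m, p m * firstAccept (accept p q (level p q m)) ω o

lemma rejectionKernel_nonneg (hp0 : ∀ m, 0 ≤ p m) (hq0 : ∀ m, 0 ≤ q m)
    (habs : ∀ m, 0 < p m → 0 < q m) (ω : Fin N → M) (o : Option (Fin N)) :
    0 ≤ rejectionKernel p q ω o :=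
  Finset.sum_nonneg fun m _ => mul_nonneg (hp0 m)
    (firstAccept_nonneg (accept_nonneg hp0 hq0 _) (accept_le_one hp0 habs _) ω o)

lemma sum_rejectionKernel (hp1 : ∑ m, p m = 1) (ω : Fin N → M) :
    ∑ o, rejectionKernel p q ω o = 1 := by
  simp only [rejectionKernel]
  rw [Finset.sum_comm]
  simp only [← Finset.mul_sum, sum_firstAccept, mul_one, hp1]

lemma pos_of_rejectionKernel_pos (hp0 : ∀ m, 0 ≤ p m) {ω : Fin N → M} {j : Fin N}
    (h : 0 < rejectionKernel p q ω (some j)) : 0 < p (ω j) := by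
  refine (hp0 _).lt_of_ne' fun hp => h.ne' ?_
  have haccept : ∀ s, accept p q s (ω j) = 0 := fun s => by simp [accept, hp]
  simp [rejectionKernel, firstAccept, haccept]

lemma sum_mul_rejectionKernel {ι : Type*} [Fintype ι] (W : (Fin N → M) → ℝ)
    (o : ι → Option (Fin N)) (H : (Fin N → M) → ι → ℝ) :
    ∑ ω, W ω * ∑ i, rejectionKernel p q ω (o i) * H ω i =
      ∑ m, p m * ∑ ω, W ω * ∑ i, firstAccept (accept p q (level p q m)) ω (o i) * H ω i := by
  have hω : ∀ ω, W ω * ∑ i, rejectionKernel p q ω (o i) * H ω i =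
      ∑ m, p m * (W ω * ∑ i, firstAccept (accept p q (level p q m)) ω (o i) * H ω i) := by
    intro ω
    simp only [rejectionKernel, Finset.sum_mul]
    rw [Finset.sum_comm, Finset.mul_sum]
    refine Finset.sum_congr rfl fun m _ => ?_
    simp only [mul_assoc, ← Finset.mul_sum]
    exact mul_left_comm _ _ _
  simp only [hω]
  rw [Finset.sum_comm]
  simp only [Finset.mul_sum]

lemma sum_rejectionKernel_none (hq1 : ∑ m, q m = 1) (N : ℕ) :
    ∑ ω : Fin N → M, (∏ i, q (ω i)) * rejectionKernel p q ω none =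
      ∑ m, p m * (1 - ∑ m', q m' * accept p q (level p q m) m') ^ N := by
  have h := sum_mul_rejectionKernel (p := p) (q := q) (N := N)
    (fun ω => ∏ i, q (ω i)) (fun _ : Unit => none) (fun _ _ => 1)
  simpa only [Finset.univ_unique, Finset.sum_singleton, mul_one,
    sum_prod_mul_firstAccept_none hq1] using h

lemma tendsto_sum_rejectionKernel_none (hp0 : ∀ m, 0 ≤ p m) (hq : q ∈ stdSimplex ℝ M)
    (habs : ∀ m, 0 < p m → 0 < q m) :
    Filter.Tendsto (fun N => ∑ ω : Fin N → M, (∏ i, q (ω i)) * rejectionKernel p q ω none)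
      Filter.atTop (nhds 0) := by
  simp only [sum_rejectionKernel_none hq.2]
  rw [← Finset.sum_const_zero (s := Finset.univ (α := M))]
  refine tendsto_finsetSum _ fun m _ => ?_
  rcases (hp0 m).eq_or_lt with hm | hm
  · simp [← hm]
  · have hpos := sum_mul_accept_pos hp0 habs hm
    have hle := sum_mul_accept_le_one hp0 hq habs (level p q m)
    simpa using (tendsto_pow_atTop_nhds_zero_of_lt_one (sub_nonneg.2 hle)
      (sub_lt_self 1 hpos)).const_mul (p m)

lemma sum_rejectionKernel_output_le [DecidableEq M] (hp0 : ∀ m, 0 ≤ p m)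
    (hq : q ∈ stdSimplex ℝ M) (habs : ∀ m, 0 < p m → 0 < q m) (N : ℕ) (m : M) :
    ∑ ω : Fin N → M, (∏ i, q (ω i)) *
      ∑ j, rejectionKernel p q ω (some j) * (if ω j = m then 1 else 0) ≤ p m := by
  set A : ℝ := ∑ m', q m' * accept p q (level p q m) m' with hA
  have hterm (m' : M) : p m' * ∑ ω : Fin N → M, (∏ i, q (ω i)) *
        ∑ j, firstAccept (accept p q (level p q m')) ω (some j) * (if ω j = m then 1 else 0) =
      (if level p q m' = level p q m then p m' else 0) *
        ((∑ j : Fin N, (1 - A) ^ (j : ℕ)) * (p m / 2 ^ level p q m)) := by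
    rw [hA, sum_prod_mul_firstAccept_output hq.2 _ fun n => if n = m then 1 else 0]
    simp only [mul_ite, mul_one, mul_zero, Finset.sum_ite_eq', Finset.mem_univ, if_true]
    rw [mul_accept hp0 habs _ m]
    by_cases h : level p q m' = level p q m
    · simp only [h, if_true]
    · simp [h, Ne.symm h]
  rw [sum_mul_rejectionKernel (fun ω : Fin N → M => ∏ i, q (ω i)) some
    fun ω j => if ω j = m then 1 else 0]
  calc _ = levelMass p q (level p q m) *
        ((∑ j : Fin N, (1 - A) ^ (j : ℕ)) * (p m / 2 ^ level p q m)) := by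
        simp only [hterm, ← Finset.sum_mul, levelMass]
    _ = p m * ((∑ j : Fin N, (1 - A) ^ (j : ℕ)) * A) := by
        rw [hA, sum_mul_accept hp0 habs]
        ring
    _ = p m * (1 - (1 - A) ^ N) := by rw [Finset.sum_mul, sum_geometric_mul]
    _ ≤ p m := mul_le_of_le_one_right (hp0 m) (sub_le_self 1
        (pow_nonneg (sub_nonneg.2 (sum_mul_accept_le_one hp0 hq habs _)) N))

lemma sum_rejectionKernel_length_le (hp : p ∈ stdSimplex ℝ M) (hq : q ∈ stdSimplex ℝ M)
    (habs : ∀ m, 0 < p m → 0 < q m) (N : ℕ) :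
    ∑ ω : Fin N → M, (∏ i, q (ω i)) *
      ∑ o, rejectionKernel p q ω o * ((indexCode o).length : ℝ) ≤ 4 * relEntropy p q + 14 := by
  have hterm : ∀ m, p m * ∑ ω : Fin N → M, (∏ i, q (ω i)) *
        ∑ o, firstAccept (accept p q (level p q m)) ω o * ((indexCode o).length : ℝ) ≤
      2 * (p m * -Real.logb 2 (levelMass p q (level p q m))) +
        2 * (p m * level p q m) + 4 * p m := by
    intro m
    rcases (hp.1 m).eq_or_lt with hm | hm
    · simp [← hm]
    · have hlen := sum_prod_mul_firstAccept_length_le hq.2 (sum_mul_accept_pos hp.1 habs hm)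
        (sum_mul_accept_le_one hp.1 hq habs _) N
      have hmass := hm.trans_le (le_levelMass (q := q) hp.1 m)
      refine (mul_le_mul_of_nonneg_left hlen hm.le).trans_eq ?_
      rw [sum_mul_accept hp.1 habs, Real.logb_div hmass.ne' (by positivity), Real.logb_pow,
        Real.logb_self_eq_one one_lt_two]
      ring
  rw [sum_mul_rejectionKernel (fun ω : Fin N → M => ∏ i, q (ω i)) (fun o => o)
    fun _ o => ((indexCode o).length : ℝ)]
  refine (Finset.sum_le_sum fun m _ => hterm m).trans ?_
  rw [Finset.sum_add_distrib, Finset.sum_add_distrib, ← Finset.mul_sum, ← Finset.mul_sum,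
    ← Finset.mul_sum, hp.2]
  linarith [sum_mul_neg_logb_levelMass_le (q := q) hp, sum_mul_level_le hp hq habs]

end RejectionSampling

section Completion

variable {M : Type*} [Fintype M]

/-- The subprobability `p` completed to a probability distribution by one additional outcome. -/
def completion (p : M → ℝ) (o : Option M) : ℝ := o.elim (1 - ∑ m, p m) p

lemma completion_mem_stdSimplex {p : M → ℝ} (hp0 : ∀ m, 0 ≤ p m) (hp1 : ∑ m, p m ≤ 1) :
    completion p ∈ stdSimplex ℝ (Option M) := by
  refine ⟨Option.rec (sub_nonneg.2 hp1) hp0, ?_⟩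
  simp [Fintype.sum_option, completion]

lemma relEntropy_completion {p : M → ℝ} (hp1 : ∑ m, p m = 1) (q : M → ℝ) :
    relEntropy (completion p) (completion q) = relEntropy p q := by
  simp [relEntropy, Fintype.sum_option, completion, hp1]

lemma exists_completion_of_good {X : Type*} {good : X → Prop} {p : X → M → ℝ} {q : M → ℝ}
    (hp : ∀ x, good x → p x ∈ stdSimplex ℝ M)
    (hq0 : ∀ m, 0 ≤ q m) (hq1 : ∑ m, q m ≤ 1)
    (habs : ∀ x, good x → ∀ m, 0 < p x m → 0 < q m) :
    ∃ p' : X → Option M → ℝ, (∀ x, p' x ∈ stdSimplex ℝ (Option M)) ∧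
      (∀ x o, 0 < p' x o → 0 < completion q o) ∧ ∀ x, good x → p' x = completion (p x) := by
  classical
  refine ⟨fun x => if good x then completion (p x) else completion q, fun x => ?_, fun x o ho => ?_,
    fun x hx => if_pos hx⟩
  · dsimp only
    split_ifs with hx
    · exact completion_mem_stdSimplex (hp x hx).1 (hp x hx).2.le
    · exact completion_mem_stdSimplex hq0 hq1
  · dsimp only at ho
    split_ifs at ho with hx
    · cases o with
      | none => simp [completion, (hp x hx).2] at ho
      | some m => exact habs x hx m ho
    · exact ho

end Completion

section MessageCode

variable {M X : Type*} [Fintype M] [Fintype X]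

/-- The joint distribution of the public samples `r.1` and of the indices `r.2` that the senders
with all possible inputs announce; given the samples, these indices are independent. -/
def codeWeight (p : X → M → ℝ) (q : M → ℝ) {N : ℕ} (r : (Fin N → M) × (X → Option (Fin N))) : ℝ :=
  (∏ i, q (r.1 i)) * ∏ x, rejectionKernel (p x) q r.1 (r.2 x)

variable {p : X → M → ℝ} {q : M → ℝ}

lemma pos_of_codeWeight_pos (hp0 : ∀ x m, 0 ≤ p x m) (hq0 : ∀ m, 0 ≤ q m)
    (habs : ∀ x m, 0 < p x m → 0 < q m) {N : ℕ} {r : (Fin N → M) × (X → Option (Fin N))}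
    (hr : 0 < codeWeight p q r) {x : X} {j : Fin N} (hj : r.2 x = some j) : 0 < p x (r.1 j) := by
  have hne : rejectionKernel (p x) q r.1 (r.2 x) ≠ 0 := fun h =>
    hr.ne' (by rw [codeWeight, Finset.prod_eq_zero (Finset.mem_univ x) h, mul_zero])
  refine pos_of_rejectionKernel_pos (hp0 x) (q := q) ?_
  rw [← hj]
  exact (rejectionKernel_nonneg (hp0 x) hq0 (habs x) _ _).lt_of_ne' hne

variable [DecidableEq X]

lemma sum_codeWeight_mul (hp1 : ∀ x, ∑ m, p x m = 1) {N : ℕ} (x : X)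
    (H : (Fin N → M) → Option (Fin N) → ℝ) :
    ∑ r, codeWeight p q r * H r.1 (r.2 x) =
      ∑ ω : Fin N → M, (∏ i, q (ω i)) * ∑ o, rejectionKernel (p x) q ω o * H ω o := by
  rw [Fintype.sum_prod_type]
  refine Finset.sum_congr rfl fun ω _ => ?_
  simp only [codeWeight, mul_assoc]
  rw [← Finset.mul_sum, sum_prod_pi_apply (fun x o => rejectionKernel (p x) q ω o)
    (fun x => sum_rejectionKernel (hp1 x) ω) x (H ω)]

lemma codeWeight_mem_stdSimplex (hp : ∀ x, p x ∈ stdSimplex ℝ M) (hq : q ∈ stdSimplex ℝ M)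
    (habs : ∀ x m, 0 < p x m → 0 < q m) (N : ℕ) :
    codeWeight p q ∈ stdSimplex ℝ ((Fin N → M) × (X → Option (Fin N))) := by
  refine ⟨fun r => mul_nonneg (Finset.prod_nonneg fun i _ => hq.1 _) (Finset.prod_nonneg fun x _ =>
    rejectionKernel_nonneg (hp x).1 hq.1 (habs x) _ _), ?_⟩
  have hindices (ω : Fin N → M) :
      ∑ φ : X → Option (Fin N), ∏ x, rejectionKernel (p x) q ω (φ x) = 1 :=
    sum_prod_pi_eq_one fun x => sum_rejectionKernel (hp x).2 ω
  rw [Fintype.sum_prod_type]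
  simp only [codeWeight, ← Finset.mul_sum, hindices, mul_one]
  exact sum_prod_pi_eq_one fun _ => hq.2

/-- The sender with input `x` wants to send a message with
distribution `p x`, and the receiver knows the prior `q`. With the public samples `r.1` it is enough
to send an index. -/
theorem exists_message_code [DecidableEq M] (hp : ∀ x, p x ∈ stdSimplex ℝ M)
    (hq : q ∈ stdSimplex ℝ M) (habs : ∀ x m, 0 < p x m → 0 < q m) {η : ℝ} (hη : 0 < η) :
    ∃ N : ℕ, ∃ w ∈ stdSimplex ℝ ((Fin N → M) × (X → Option (Fin N))),
      (∀ r, 0 < w r → ∀ x j, r.2 x = some j → 0 < p x (r.1 j)) ∧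
      ∀ x, (∀ m, ∑ r, w r * (if (r.2 x).map r.1 = some m then 1 else 0) ≤ p x m) ∧
        ∑ r, w r * (if r.2 x = none then 1 else 0) ≤ η ∧
        ∑ r, w r * ((indexCode (r.2 x)).length : ℝ) ≤ 4 * relEntropy (p x) q + 14 := by
  have hfail : ∀ x, ∀ᶠ N in Filter.atTop,
      ∑ ω : Fin N → M, (∏ i, q (ω i)) * rejectionKernel (p x) q ω none ≤ η := fun x =>
    (tendsto_sum_rejectionKernel_none (hp x).1 hq (habs x)).eventually_le_const hη
  obtain ⟨N, hN⟩ := (Filter.eventually_all.2 hfail).exists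
  refine ⟨N, codeWeight p q, codeWeight_mem_stdSimplex hp hq habs N,
    fun r hr x j hj => pos_of_codeWeight_pos (fun x => (hp x).1) hq.1 habs hr hj,
    fun x => ⟨fun m => ?_, ?_, ?_⟩⟩
  · rw [sum_codeWeight_mul (fun x => (hp x).2) x fun ω o => if o.map ω = some m then 1 else 0]
    refine le_of_eq_of_le ?_ (sum_rejectionKernel_output_le (hp x).1 hq (habs x) N m)
    simp [Fintype.sum_option]
  · rw [sum_codeWeight_mul (fun x => (hp x).2) x fun _ o => if o = none then 1 else 0]
    simpa using hN x
  · rw [sum_codeWeight_mul (fun x => (hp x).2) x fun _ o => ((indexCode o).length : ℝ)]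
    exact sum_rejectionKernel_length_le (hp x) hq (habs x) N

lemma sum_mul_ite_bind_eq_none_le {ι J L : Type*} [Fintype ι] [DecidableEq L] {w : ι → ℝ}
    (hw : ∀ r, 0 ≤ w r) (o : ι → Option J) (φ : ι → J → Option L) :
    ∑ r, w r * (if (o r).bind (φ r) = none then 1 else 0) ≤
      ∑ r, w r * (if o r = none then 1 else 0) +
        ∑ r, w r * (if (o r).map (φ r) = some none then 1 else 0) := by
  rw [← Finset.sum_add_distrib]
  refine Finset.sum_le_sum fun r _ => ?_
  rw [← mul_add]
  refine mul_le_mul_of_nonneg_left ?_ (hw r)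
  cases o r <;> simp

/-- The version of `exists_message_code` for a prior of total mass at most `1`: the missing mass is
that of samples which stand for no message, so decoding the index `r.2 x` gives
`(r.2 x).bind r.1`. -/
theorem exists_message_code_of_sum_le_one [DecidableEq M] {good : X → Prop}
    (hp : ∀ x, good x → p x ∈ stdSimplex ℝ M) (hq0 : ∀ m, 0 ≤ q m) (hq1 : ∑ m, q m ≤ 1)
    (habs : ∀ x, good x → ∀ m, 0 < p x m → 0 < q m) {η : ℝ} (hη : 0 < η) :
    ∃ N : ℕ, ∃ w ∈ stdSimplex ℝ ((Fin N → Option M) × (X → Option (Fin N))),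
      (∀ r, 0 < w r → ∀ x, good x → ∀ m, (r.2 x).bind r.1 = some m → 0 < p x m) ∧
      ∀ x, good x →
        (∀ m, ∑ r, w r * (if (r.2 x).bind r.1 = some m then 1 else 0) ≤ p x m) ∧
        ∑ r, w r * (if (r.2 x).bind r.1 = none then 1 else 0) ≤ η ∧
        ∑ r, w r * ((indexCode (r.2 x)).length : ℝ) ≤ 4 * relEntropy (p x) q + 14 := by
  obtain ⟨p', hp', habs', hgood⟩ := exists_completion_of_good hp hq0 hq1 habs
  obtain ⟨N, w, hw, hpos, hcode⟩ :=
    exists_message_code hp' (completion_mem_stdSimplex hq0 hq1) habs' hη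
  refine ⟨N, w, hw, fun r hr x hx m hm => ?_, fun x hx => ?_⟩
  · obtain ⟨j, hj, hjm⟩ := Option.bind_eq_some_iff.1 hm
    simpa [hjm, hgood x hx, completion] using hpos r hr x j hj
  obtain ⟨hout, hfail, hlen⟩ := hcode x
  rw [hgood x hx] at hout hlen
  refine ⟨fun m => ?_, ?_, ?_⟩
  · simpa [completion, Option.bind_eq_some_iff] using hout (some m)
  · have hblank := hout none
    simp only [completion, (hp x hx).2, sub_self, Option.elim_none] at hblank
    linarith [sum_mul_ite_bind_eq_none_le hw.1 (fun r => r.2 x) fun r => r.1]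
  · rwa [relEntropy_completion (hp x hx).2] at hlen

end MessageCode

/-! ### The chain rule for transcripts -/

/-- A nonnegative weight on histories, such that the extensions of a history by one message weigh
together at most as much as the history itself. -/
structure IsSemimeasure (q : History → ℝ) : Prop where
  nonneg : ∀ h, 0 ≤ q h
  sum_le : ∀ h (S : Finset (List Bool)), ∑ m ∈ S, q (h ++ [m]) ≤ q h

namespace IsSemimeasure

variable {q : History → ℝ}

lemma cons (hq : IsSemimeasure q) (m : List Bool) : IsSemimeasure fun h => q (m :: h) where
  nonneg _ := hq.nonneg _
  sum_le h S := hq.sum_le (m :: h) S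

lemma append_le (hq : IsSemimeasure q) (h t : History) : q (h ++ t) ≤ q h := by
  induction t generalizing h with
  | nil => rw [List.append_nil]
  | cons m t ih =>
    have hstep := hq.sum_le h {m}
    rw [Finset.sum_singleton] at hstep
    rw [List.append_cons]
    exact (ih _).trans hstep

lemma sum_le_nil (hq : IsSemimeasure q) {n : ℕ} {S : Finset History}
    (hS : ∀ t ∈ S, t.length = n) : ∑ t ∈ S, q t ≤ q [] := by
  induction n generalizing q S with
  | zero =>
    have hsub : S ⊆ {[]} := fun t ht => by simpa using hS t ht
    exact (Finset.sum_le_sum_of_subset_of_nonneg hsub fun t _ _ => hq.nonneg t).trans_eq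
      (Finset.sum_singleton _ _)
  | succ n ih =>
    rw [← Finset.sum_fiberwise_of_maps_to (s := S) (t := S.image fun t => t.headD [])
      (g := fun t => t.headD []) (fun t ht => Finset.mem_image_of_mem _ ht)]
    refine le_trans (Finset.sum_le_sum fun m _ => ?_) (hq.sum_le [] (S.image fun t => t.headD []))
    have hcons : ∀ t ∈ S.filter (fun t => t.headD [] = m), t = m :: t.tail := by
      intro t ht
      obtain ⟨htS, rfl⟩ := Finset.mem_filter.1 ht
      cases t with
      | nil => simpa using hS _ htS
      | cons a t => rfl
    have htail : ∑ t ∈ S with t.headD [] = m, q t =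
        ∑ t ∈ (S.filter (fun t => t.headD [] = m)).image List.tail, q (m :: t) := by
      rw [Finset.sum_image fun t ht t' ht' htt => by rw [hcons t ht, hcons t' ht', htt]]
      exact Finset.sum_congr rfl fun t ht => congrArg q (hcons t ht)
    rw [htail]
    refine ih (hq.cons m) fun t ht => ?_
    obtain ⟨t, htS, rfl⟩ := Finset.mem_image.1 ht
    simp [hS t (Finset.mem_filter.1 htS).1]

end IsSemimeasure

/-- The total weight of the pairs of coins on input `(x, y)`, when the coins of the parties have the
weights `α x` and `β y`. These are not normalised, because the weights of Alice's coins get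
restricted to those compatible with the messages she has already sent. -/
def coinMass {X Y A B : Type*} [Fintype A] [Fintype B] (α : X → A → ℝ) (β : Y → B → ℝ)
    (x : X) (y : Y) : ℝ := (∑ a, α x a) * ∑ b, β y b

lemma coinMass_nonneg {X Y A B : Type*} [Fintype A] [Fintype B] {α : X → A → ℝ} {β : Y → B → ℝ}
    (hα : ∀ x a, 0 ≤ α x a) (hβ : ∀ y b, 0 ≤ β y b) (x : X) (y : Y) : 0 ≤ coinMass α β x y :=
  mul_nonneg (Finset.sum_nonneg fun a _ => hα x a) (Finset.sum_nonneg fun b _ => hβ y b)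

namespace DetProtocol

section Masses

variable {first out : Player} {k : ℕ} {X Y Z A B : Type*} [Fintype A] [Fintype B]

/-- The weight of the transcript `t` on input `(x, y)`, when the parties hold coins with the
weights `α x` and `β y`. -/
def transMass (P : DetProtocol first out k (X × A) (Y × B) Z) (α : X → A → ℝ) (β : Y → B → ℝ)
    (x : X) (y : Y) (t : History) : ℝ :=
  ∑ a, ∑ b, if P.transcript (x, a) (y, b) = t then α x a * β y b else 0

open scoped Classical in
/-- The weight of a wrong answer on input `(x, y)`. -/
def errMass (P : DetProtocol first out k (X × A) (Y × B) Z) (f : X → Y → Z) (α : X → A → ℝ)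
    (β : Y → B → ℝ) (x : X) (y : Y) : ℝ :=
  ∑ a, ∑ b, if P.answer (x, a) (y, b) ≠ f x y then α x a * β y b else 0

/-- The divergence, in bits, of the transcript on input `(x, y)` from the prior `q`, multiplied by
the total weight of the coins. -/
def infoMass (P : DetProtocol first out k (X × A) (Y × B) Z) (α : X → A → ℝ) (β : Y → B → ℝ)
    (q : History → ℝ) (x : X) (y : Y) : ℝ :=
  ∑ a, ∑ b, α x a * β y b * Real.logb 2
    (P.transMass α β x y (P.transcript (x, a) (y, b)) / coinMass α β x y /
      (q (P.transcript (x, a) (y, b)) / q []))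

/-- The bound on the weighted error and communication of the compressed protocol on input
`(x, y)`. Each round costs `4` bits per bit of divergence, `14` further bits and a failure
probability `η`, as in `exists_message_code`; a bit costs `lam` errors. -/
def simBound (P : DetProtocol first out k (X × A) (Y × B) Z) (f : X → Y → Z) (α : X → A → ℝ)
    (β : Y → B → ℝ) (q : History → ℝ) (lam η : ℝ) (x : X) (y : Y) : ℝ :=
  P.errMass f α β x y + lam * (4 * P.infoMass α β q x y + 14 * k * coinMass α β x y) +
    k * η * coinMass α β x y

variable {P : DetProtocol first out k (X × A) (Y × B) Z} {f : X → Y → Z} {α : X → A → ℝ}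
  {β : Y → B → ℝ} {q : History → ℝ} {x : X} {y : Y}

lemma errMass_nonneg (hα : ∀ x a, 0 ≤ α x a) (hβ : ∀ y b, 0 ≤ β y b) :
    0 ≤ P.errMass f α β x y := by
  refine Finset.sum_nonneg fun a _ => Finset.sum_nonneg fun b _ => ?_
  split_ifs
  exacts [mul_nonneg (hα x a) (hβ y b), le_rfl]

lemma le_transMass (hα : ∀ x a, 0 ≤ α x a) (hβ : ∀ y b, 0 ≤ β y b) (a : A) (b : B) :
    α x a * β y b ≤ P.transMass α β x y (P.transcript (x, a) (y, b)) := by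
  unfold transMass
  rw [← Fintype.sum_prod_type']
  have h := Finset.single_le_sum (s := Finset.univ) (f := fun p : A × B =>
    if P.transcript (x, p.1) (y, p.2) = P.transcript (x, a) (y, b) then α x p.1 * β y p.2 else 0)
    (fun p _ => by have := mul_nonneg (hα x p.1) (hβ y p.2); split_ifs <;> simp [this])
    (Finset.mem_univ (a, b))
  simpa using h

lemma sum_mul_prior_div_transMass_le (hq : IsSemimeasure q) :
    ∑ p : A × B, α x p.1 * β y p.2 * (q (P.transcript (x, p.1) (y, p.2)) / q [] /
      P.transMass α β x y (P.transcript (x, p.1) (y, p.2))) ≤ 1 := by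
  have hfiber := sum_mul_div_sum_fiber_le (fun p : A × B => P.transcript (x, p.1) (y, p.2))
    (fun p => α x p.1 * β y p.2) (r := fun t => q t / q [])
    fun t => div_nonneg (hq.nonneg _) (hq.nonneg _)
  simp only [Fintype.sum_prod_type] at hfiber ⊢
  refine hfiber.trans ?_
  rw [← Finset.sum_div]
  refine div_le_one_of_le₀ (hq.sum_le_nil (n := k) fun t ht => ?_) (hq.nonneg _)
  obtain ⟨p, _, rfl⟩ := Finset.mem_image.1 ht
  exact P.length_transcript _ _

lemma infoMass_nonneg (hα : ∀ x a, 0 ≤ α x a) (hβ : ∀ y b, 0 ≤ β y b) (hq : IsSemimeasure q)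
    (habs : ∀ a b, 0 < α x a → 0 < β y b → 0 < q (P.transcript (x, a) (y, b))) :
    0 ≤ P.infoMass α β q x y := by
  let T : A × B → History := fun p => P.transcript (x, p.1) (y, p.2)
  let w : A × B → ℝ := fun p => α x p.1 * β y p.2
  have hw (p : A × B) : 0 ≤ w p := mul_nonneg (hα _ _) (hβ _ _)
  have hw1 : ∑ p, w p = coinMass α β x y := by
    rw [coinMass, Finset.sum_mul_sum, ← Fintype.sum_prod_type']
  have hratio (p : A × B) (hp : 0 < w p) :
      0 < q (T p) / q [] / (P.transMass α β x y (T p) / coinMass α β x y) := by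
    have ha : 0 < α x p.1 := (hα _ _).lt_of_ne' (left_ne_zero_of_mul hp.ne')
    have hb : 0 < β y p.2 := (hβ _ _).lt_of_ne' (right_ne_zero_of_mul hp.ne')
    have hqT : 0 < q (T p) := habs _ _ ha hb
    have hmass : 0 < coinMass α β x y :=
      hw1 ▸ hp.trans_le (Finset.single_le_sum (fun p _ => hw p) (Finset.mem_univ p))
    exact div_pos (div_pos hqT (hqT.trans_le (hq.append_le [] (T p))))
      (div_pos (hp.trans_le (le_transMass hα hβ _ _)) hmass)
  have hjensen := sum_mul_logb_nonpos one_lt_two hw hratio (by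
    have h := mul_le_mul_of_nonneg_left
      (sum_mul_prior_div_transMass_le (P := P) (α := α) (β := β) (x := x) (y := y) hq)
      (coinMass_nonneg hα hβ x y)
    rw [mul_one, Finset.mul_sum] at h
    rw [hw1]
    refine (Finset.sum_le_sum fun p _ => le_of_eq ?_).trans h
    rw [div_div_eq_mul_div]
    ring)
  have hinfo : P.infoMass α β q x y =
      -∑ p, w p * Real.logb 2
        (q (T p) / q [] / (P.transMass α β x y (T p) / coinMass α β x y)) := by
    rw [infoMass, ← Fintype.sum_prod_type', ← Finset.sum_neg_distrib]
    exact Finset.sum_congr rfl fun p _ => by rw [← mul_neg, ← Real.logb_inv, inv_div]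
  rw [hinfo]
  exact neg_nonneg.2 hjensen

lemma simBound_nonneg {lam η : ℝ} (hlam : 0 ≤ lam) (hη : 0 ≤ η) (hα : ∀ x a, 0 ≤ α x a)
    (hβ : ∀ y b, 0 ≤ β y b) (hq : IsSemimeasure q)
    (habs : ∀ a b, 0 < α x a → 0 < β y b → 0 < q (P.transcript (x, a) (y, b))) :
    0 ≤ P.simBound f α β q lam η x y := by
  have herr := errMass_nonneg (P := P) (f := f) (x := x) (y := y) hα hβ
  have hinfo := infoMass_nonneg hα hβ hq habs
  have hmass := coinMass_nonneg hα hβ x y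
  unfold simBound
  positivity

end Masses

section FirstMessage

variable {out : Player} {k : ℕ} {X Y Z A B : Type*}

/-- The weights of Alice's coins, restricted to the event that her first message is `m`. -/
def restrict (P : DetProtocol .alice out (k + 1) (X × A) (Y × B) Z) (α : X → A → ℝ)
    (m : List Bool) (x : X) (a : A) : ℝ :=
  if P.msgA [] (x, a) = m then α x a else 0

variable (P : DetProtocol .alice out (k + 1) (X × A) (Y × B) Z) {α : X → A → ℝ}

lemma restrict_nonneg (hα : ∀ x a, 0 ≤ α x a) (m : List Bool) (x : X) (a : A) :
    0 ≤ P.restrict α m x a := by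
  unfold restrict
  split_ifs
  exacts [hα x a, le_rfl]

lemma transcript_eq_msgA_cons (p : X × A) (r : Y × B) :
    P.transcript p r = P.msgA [] p :: (P.tail (P.msgA [] p)).transcript p r :=
  P.transcript_eq_cons p r

variable [Fintype X] [Fintype A]

/-- The possible first messages of Alice. -/
def firstMessages (P : DetProtocol .alice out (k + 1) (X × A) (Y × B) Z) : Finset (List Bool) :=
  Finset.univ.image (P.msgA [])

variable {x : X}

lemma sum_restrict (F : List Bool → A → ℝ) :
    ∑ m ∈ P.firstMessages, ∑ a, P.restrict α m x a * F m a =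
      ∑ a, α x a * F (P.msgA [] (x, a)) a := by
  rw [Finset.sum_comm]
  refine Finset.sum_congr rfl fun a _ => ?_
  simp only [restrict, ite_mul, zero_mul, Finset.sum_ite_eq]
  exact if_pos (Finset.mem_image_of_mem _ (Finset.mem_univ _))

lemma sum_total_restrict :
    ∑ m ∈ P.firstMessages, ∑ a, P.restrict α m x a = ∑ a, α x a := by
  simpa only [mul_one] using P.sum_restrict (α := α) (x := x) fun _ _ => 1

variable [Fintype B] {f : X → Y → Z} {β : Y → B → ℝ} {q : History → ℝ} {y : Y}

lemma sum_coinMass_restrict :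
    ∑ m ∈ P.firstMessages, coinMass (P.restrict α m) β x y = coinMass α β x y := by
  simp only [coinMass, ← Finset.sum_mul, sum_total_restrict]

lemma errMass_eq_sum_tail :
    P.errMass f α β x y =
      ∑ m ∈ P.firstMessages, (P.tail m).errMass f (P.restrict α m) β x y := by
  classical
  have h := P.sum_restrict (α := α) (x := x) fun m a =>
    ∑ b, if (P.tail m).answer (x, a) (y, b) ≠ f x y then β y b else 0
  simp only [Finset.mul_sum, mul_ite, mul_zero] at h
  unfold errMass
  rw [h]
  refine Finset.sum_congr rfl fun a _ => Finset.sum_congr rfl fun b _ => ?_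
  rw [P.answer_eq_tail]
  rfl

end FirstMessage

section ChainRule

variable {out : Player} {k : ℕ} {X Y Z A B : Type*} [Fintype A] [Fintype B]
  (P : DetProtocol .alice out (k + 1) (X × A) (Y × B) Z) {α : X → A → ℝ} {β : Y → B → ℝ}
  {q : History → ℝ} {x : X} {y : Y}

lemma transMass_restrict (m : List Bool) (t : History) :
    (P.tail m).transMass (P.restrict α m) β x y t = P.transMass α β x y (m :: t) := by
  unfold transMass
  refine Finset.sum_congr rfl fun a _ => Finset.sum_congr rfl fun b _ => ?_
  rw [transcript_eq_msgA_cons, restrict]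
  by_cases h : P.msgA [] (x, a) = m <;> simp [h]

lemma logb_ratio_eq_add_tail (hα : ∀ x a, 0 ≤ α x a) (hβ : ∀ y b, 0 ≤ β y b)
    (hq : IsSemimeasure q) {a : A} {b : B} (ha : 0 < α x a) (hb : 0 < β y b)
    (hqT : 0 < q (P.transcript (x, a) (y, b))) {m : List Bool} (hm : P.msgA [] (x, a) = m) :
    Real.logb 2 (P.transMass α β x y (P.transcript (x, a) (y, b)) / coinMass α β x y /
        (q (P.transcript (x, a) (y, b)) / q [])) =
      Real.logb 2 ((P.tail m).transMass (P.restrict α m) β x y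
          ((P.tail m).transcript (x, a) (y, b)) / coinMass (P.restrict α m) β x y /
        (q (m :: (P.tail m).transcript (x, a) (y, b)) / q [m])) +
      Real.logb 2 ((∑ a, P.restrict α m x a) / (∑ a, α x a) / (q [m] / q [])) := by
  have hT := P.transcript_eq_msgA_cons (x, a) (y, b)
  rw [hm] at hT
  have hsα : 0 < ∑ a, α x a :=
    ha.trans_le (Finset.single_le_sum (fun a _ => hα x a) (Finset.mem_univ a))
  have hsβ : 0 < ∑ b, β y b :=
    hb.trans_le (Finset.single_le_sum (fun b _ => hβ y b) (Finset.mem_univ b))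
  have hsr : 0 < ∑ a, P.restrict α m x a := by
    have hle := Finset.single_le_sum (fun a _ => P.restrict_nonneg hα m x a) (Finset.mem_univ a)
    rw [restrict, if_pos hm] at hle
    exact ha.trans_le hle
  have htrans : 0 < P.transMass α β x y (P.transcript (x, a) (y, b)) :=
    (mul_pos ha hb).trans_le (le_transMass hα hβ a b)
  have hqm : 0 < q [m] := by
    rw [hT] at hqT
    exact hqT.trans_le (hq.append_le [m] _)
  have hq0 : 0 < q [] := hqm.trans_le (hq.append_le [] _)
  rw [transMass_restrict, ← hT, coinMass, coinMass, ← Real.logb_mul (by positivity) (by positivity)]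
  congr 1
  field_simp

variable [Fintype X]

/-- The distribution of Alice's first message on input `x`. -/
def firstMessageDist (α : X → A → ℝ) (x : X) (m : P.firstMessages) : ℝ :=
  (∑ a, P.restrict α m x a) / ∑ a, α x a

/-- The conditional probability of a first message under the prior `q`. -/
def firstMessagePrior (q : History → ℝ) (m : P.firstMessages) : ℝ := q [(m : List Bool)] / q []

lemma coinMass_restrict (hα : ∀ x a, 0 ≤ α x a) (m : P.firstMessages) :
    coinMass (P.restrict α m) β x y = coinMass α β x y * P.firstMessageDist α x m := by
  rw [coinMass, coinMass, firstMessageDist]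
  rcases eq_or_ne (∑ a, α x a) 0 with hsα | hsα
  · have hα0 : ∀ a, α x a = 0 := fun a =>
      (Finset.sum_eq_zero_iff_of_nonneg fun a _ => hα x a).1 hsα a (Finset.mem_univ a)
    simp [restrict, hα0]
  · field_simp

lemma infoMass_eq_sum_tail (hα : ∀ x a, 0 ≤ α x a) (hβ : ∀ y b, 0 ≤ β y b)
    (hq : IsSemimeasure q)
    (habs : ∀ a b, 0 < α x a → 0 < β y b → 0 < q (P.transcript (x, a) (y, b))) :
    P.infoMass α β q x y =
      ∑ m ∈ P.firstMessages, (P.tail m).infoMass (P.restrict α m) β (fun h => q (m :: h)) x y +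
        coinMass α β x y * relEntropy (P.firstMessageDist α x) (P.firstMessagePrior q) := by
  let first (m : List Bool) : ℝ :=
    Real.logb 2 ((∑ a, P.restrict α m x a) / (∑ a, α x a) / (q [m] / q []))
  let rest (m : List Bool) (a : A) (b : B) : ℝ :=
    Real.logb 2 ((P.tail m).transMass (P.restrict α m) β x y
        ((P.tail m).transcript (x, a) (y, b)) / coinMass (P.restrict α m) β x y /
      (q (m :: (P.tail m).transcript (x, a) (y, b)) / q [m]))
  have hfirst : coinMass α β x y * relEntropy (P.firstMessageDist α x) (P.firstMessagePrior q) =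
      ∑ m ∈ P.firstMessages, ∑ a, P.restrict α m x a * ∑ b, β y b * first m := by
    rw [relEntropy, Finset.mul_sum, ← Finset.sum_coe_sort P.firstMessages]
    refine Finset.sum_congr rfl fun m _ => ?_
    rw [← mul_assoc, ← P.coinMass_restrict hα]
    simp only [coinMass, ← Finset.sum_mul, mul_assoc]
    rfl
  have hrest (m : List Bool) : (P.tail m).infoMass (P.restrict α m) β (fun h => q (m :: h)) x y =
      ∑ a, P.restrict α m x a * ∑ b, β y b * rest m a b := by
    simp only [infoMass, rest, Finset.mul_sum, mul_assoc]
  calc P.infoMass α β q x y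
      = ∑ a, α x a * ∑ b, β y b *
          (rest (P.msgA [] (x, a)) a b + first (P.msgA [] (x, a))) := by
        refine Finset.sum_congr rfl fun a _ => ?_
        rw [Finset.mul_sum]
        refine Finset.sum_congr rfl fun b _ => ?_
        rcases (hα x a).eq_or_lt with ha | ha
        · simp [← ha]
        rcases (hβ y b).eq_or_lt with hb | hb
        · simp [← hb]
        rw [P.logb_ratio_eq_add_tail hα hβ hq ha hb (habs a b ha hb) rfl, mul_assoc]
    _ = _ := by
        rw [← P.sum_restrict fun m a => ∑ b, β y b * (rest m a b + first m), hfirst]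
        simp only [mul_add, Finset.sum_add_distrib, hrest]

/-- The terms of the first message are the cost and the error of `exists_message_code`. -/
lemma simBound_eq_sum_tail {f : X → Y → Z} {lam η : ℝ} (hα : ∀ x a, 0 ≤ α x a)
    (hβ : ∀ y b, 0 ≤ β y b) (hq : IsSemimeasure q)
    (habs : ∀ a b, 0 < α x a → 0 < β y b → 0 < q (P.transcript (x, a) (y, b))) :
    P.simBound f α β q lam η x y =
      ∑ m ∈ P.firstMessages,
        (P.tail m).simBound f (P.restrict α m) β (fun h => q (m :: h)) lam η x y +
      coinMass α β x y * (lam *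
        (4 * relEntropy (P.firstMessageDist α x) (P.firstMessagePrior q) + 14) + η) := by
  simp only [simBound, Finset.sum_add_distrib, ← Finset.mul_sum]
  rw [← errMass_eq_sum_tail, infoMass_eq_sum_tail P hα hβ hq habs, sum_coinMass_restrict]
  push_cast
  ring

end ChainRule

end DetProtocol

/-! ### Compression -/

section Averaging

variable {R : Type*} [Fintype R] {w : R → ℝ}

lemma exists_pos_weight_mul_le (hw : ∀ r, 0 ≤ w r) (hpos : 0 < ∑ r, w r) (F : R → ℝ) :
    ∃ r, 0 < w r ∧ (∑ r, w r) * F r ≤ ∑ r, w r * F r := by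
  by_contra! hlt
  obtain ⟨r₀, hr₀⟩ : ∃ r, 0 < w r := by
    by_contra! hle
    exact hpos.not_ge (Finset.sum_nonpos fun r _ => hle r)
  have hsum : ∑ r, w r * ∑ r, w r * F r < ∑ r, w r * ((∑ r, w r) * F r) := by
    refine Finset.sum_lt_sum (fun r _ => ?_)
      ⟨r₀, Finset.mem_univ _, mul_lt_mul_of_pos_left (hlt r₀ hr₀) hr₀⟩
    rcases (hw r).eq_or_lt with h0 | h0
    · simp [← h0]
    · exact mul_le_mul_of_nonneg_left (hlt r h0).le h0.le
  simp only [mul_left_comm (w _) (∑ r, w r), ← Finset.sum_mul, ← Finset.mul_sum] at hsum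
  exact lt_irrefl _ hsum

lemma exists_pos_weight_le (hw : w ∈ stdSimplex ℝ R) (F : R → ℝ) :
    ∃ r, 0 < w r ∧ F r ≤ ∑ r, w r * F r := by
  simpa only [hw.2, one_mul] using
    exists_pos_weight_mul_le hw.1 (hw.2.symm ▸ one_pos) F

end Averaging

section Loss

variable {first out : Player} {k : ℕ} {X Y Z : Type*}

open scoped Classical in
/-- The loss of a protocol for `f` on input `(x, y)`, when a bit of communication costs `lam` wrong
answers. -/
def DetProtocol.loss (Q : DetProtocol first out k X Y Z) (f : X → Y → Z) (lam : ℝ) (x : X) (y : Y) :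
    ℝ := (if Q.answer x y ≠ f x y then 1 else 0) + lam * Q.bits x y

/-- Every protocol with the coin sets `A` and `B` can be compressed: for all weights `g` of the
inputs and all priors `q` there is a deterministic protocol whose weighted loss is controlled by the
error of the given protocol and its divergence from `q`. -/
def Compressible (first out : Player) (k : ℕ) {X Y Z : Type*} (A B : Type*) [Fintype X]
    [Fintype Y] [Fintype A] [Fintype B] (f : X → Y → Z) (lam η : ℝ) : Prop :=
  ∀ (P : DetProtocol first out k (X × A) (Y × B) Z) (α : X → A → ℝ) (β : Y → B → ℝ)
    (q : History → ℝ) (g : X → Y → ℝ), (∀ x a, 0 ≤ α x a) → (∀ y b, 0 ≤ β y b) →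
    (∀ x y, 0 ≤ g x y) → IsSemimeasure q →
    (∀ x y, 0 < g x y → ∀ a b, 0 < α x a → 0 < β y b → 0 < q (P.transcript (x, a) (y, b))) →
    ∃ Q : DetProtocol first out k X Y Z,
      ∑ x, ∑ y, g x y * coinMass α β x y * Q.loss f lam x y ≤
        ∑ x, ∑ y, g x y * P.simBound f α β q lam η x y

end Loss

section Swap

variable {first out : Player} {k : ℕ} {X Y Z A B : Type*} [Fintype A] [Fintype B]
  {f : X → Y → Z} {lam η : ℝ}

lemma coinMass_comm (α : X → A → ℝ) (β : Y → B → ℝ) (x : X) (y : Y) :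
    coinMass β α y x = coinMass α β x y := mul_comm _ _

namespace DetProtocol

lemma swap_transMass (P : DetProtocol first out k (X × A) (Y × B) Z) (α : X → A → ℝ)
    (β : Y → B → ℝ) (x : X) (y : Y) (t : History) :
    P.swap.transMass β α y x t = P.transMass α β x y t := by
  unfold transMass
  rw [Finset.sum_comm]
  simp only [swap_transcript, mul_comm]

lemma swap_errMass (P : DetProtocol first out k (X × A) (Y × B) Z) (α : X → A → ℝ)
    (β : Y → B → ℝ) (x : X) (y : Y) :
    P.swap.errMass (flip f) β α y x = P.errMass f α β x y := by
  unfold errMass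
  rw [Finset.sum_comm]
  exact Finset.sum_congr rfl fun a _ => Finset.sum_congr rfl fun b _ => by
    rw [swap_answer, mul_comm]
    rfl

lemma swap_infoMass (P : DetProtocol first out k (X × A) (Y × B) Z) (α : X → A → ℝ)
    (β : Y → B → ℝ) (q : History → ℝ) (x : X) (y : Y) :
    P.swap.infoMass β α q y x = P.infoMass α β q x y := by
  unfold infoMass
  rw [Finset.sum_comm]
  simp only [swap_transcript, swap_transMass, coinMass_comm α β, mul_comm (β y _)]

lemma swap_simBound (P : DetProtocol first out k (X × A) (Y × B) Z) (α : X → A → ℝ)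
    (β : Y → B → ℝ) (q : History → ℝ) (x : X) (y : Y) :
    P.swap.simBound (flip f) β α q lam η y x = P.simBound f α β q lam η x y := by
  rw [simBound, simBound, swap_errMass, swap_infoMass, coinMass_comm]

end DetProtocol

variable [Fintype X] [Fintype Y]

open DetProtocol

lemma Compressible.swap (h : Compressible first.other out.other k B A (flip f) lam η) :
    Compressible first out k A B f lam η := by
  intro P α β q g hα hβ hg hq habs
  obtain ⟨Q, hQ⟩ := h P.swap β α q (flip g) hβ hα (fun y x => hg x y) hq
    (fun y x hxy b a hb ha => by
      rw [swap_transcript]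
      exact habs x y hxy a b ha hb)
  obtain ⟨Q', hQ'⟩ : ∃ Q' : DetProtocol first out k X Y Z,
      ∀ x y, Q'.loss f lam x y = Q.loss (flip f) lam y x := by
    have hloss : ∀ x y, Q.swap.loss f lam x y = Q.loss (flip f) lam y x := fun x y => by
      rw [loss, loss, swap_answer, swap_bits]
      rfl
    cases first <;> cases out <;> exact ⟨Q.swap, hloss⟩
  refine ⟨Q', ?_⟩
  rw [Finset.sum_comm, Finset.sum_comm (f := fun x y => g x y * P.simBound f α β q lam η x y)]
  simpa only [swap_simBound, hQ', coinMass_comm α β, flip] using hQ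

end Swap

section NoRounds

variable {first out : Player} {X Y Z A B : Type*} [Fintype A] [Fintype B] {f : X → Y → Z}
  {lam η : ℝ}

open DetProtocol

lemma simBound_zero_rounds (P : DetProtocol first out 0 (X × A) (Y × B) Z) (α : X → A → ℝ)
    (β : Y → B → ℝ) (q : History → ℝ) (x : X) (y : Y) :
    P.simBound f α β q lam η x y = P.errMass f α β x y := by
  have htranscript : ∀ p r, P.transcript p r = [] := fun _ _ => rfl
  have htrans : P.transMass α β x y [] = coinMass α β x y := by
    simp [transMass, htranscript, coinMass, Finset.sum_mul_sum]
  have hlog : Real.logb 2 (coinMass α β x y / coinMass α β x y / (q [] / q [])) = 0 := by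
    by_cases hmass : coinMass α β x y = 0 <;> by_cases hq : q [] = 0 <;> simp [hmass, hq]
  simp [simBound, infoMass, htranscript, htrans, hlog]

variable [Fintype X] [Fintype Y]

lemma compressible_zero_alice [Nonempty Z] : Compressible first .alice 0 A B f lam η := by
  classical
  intro P α β q g hα _ _ _ _
  let err (x : X) (z : Z) : ℝ := ∑ y, g x y * ((∑ b, β y b) * if z ≠ f x y then 1 else 0)
  have hbest (x : X) : ∃ z, (∑ a, α x a) * err x z ≤ ∑ a, α x a * err x (P.outA [] (x, a)) := by
    rcases (Finset.sum_nonneg fun a _ => hα x a).eq_or_lt with hsα | hsα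
    · refine ⟨Classical.arbitrary Z, ?_⟩
      have hα0 := (Finset.sum_eq_zero_iff_of_nonneg fun a _ => hα x a).1 hsα.symm
      rw [← hsα, zero_mul]
      exact (Finset.sum_eq_zero fun a ha => by rw [hα0 a ha, zero_mul]).ge
    · obtain ⟨a, -, ha⟩ := exists_pos_weight_mul_le (hα x) hsα fun a => err x (P.outA [] (x, a))
      exact ⟨_, ha⟩
  choose z hz using hbest
  refine ⟨silent first .alice 0 z fun _ => Classical.arbitrary Z, ?_⟩
  have hloss (x : X) (y : Y) : (silent first .alice 0 z fun _ : Y => Classical.arbitrary Z).loss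
      f lam x y = if z x ≠ f x y then 1 else 0 := by
    rw [loss, silent_bits, Nat.cast_zero, mul_zero, add_zero]
    rfl
  have hanswer (x : X) (a : A) (y : Y) (b : B) : P.answer (x, a) (y, b) = P.outA [] (x, a) := rfl
  refine Finset.sum_le_sum fun x _ => le_trans (le_of_eq ?_) ((hz x).trans (le_of_eq ?_))
  · rw [Finset.mul_sum]
    exact Finset.sum_congr rfl fun y _ => by rw [hloss, coinMass]; ring
  · simp only [simBound_zero_rounds, errMass, hanswer, err, Finset.mul_sum, Finset.sum_mul]
    rw [Finset.sum_comm]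
    refine Finset.sum_congr rfl fun y _ => Finset.sum_congr rfl fun a _ =>
      Finset.sum_congr rfl fun b _ => ?_
    split_ifs <;> ring

lemma compressible_zero [Nonempty Z] : Compressible first out 0 A B f lam η := by
  cases out
  · exact compressible_zero_alice
  · exact Compressible.swap compressible_zero_alice

end NoRounds

section OneRound

variable {out : Player} {k : ℕ} {X Y Z : Type*} [Fintype X] [Fintype Y] {f : X → Y → Z}
  {lam η : ℝ} {G : X → Y → ℝ}

open DetProtocol

lemma exists_loss_le_of_code {J : Type*} [Finite J] [Nonempty J] [DecidableEq J]
    {code : J → List Bool} (hcode : ∀ i j, code i <+: code j → i = j) (e : X → J)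
    {D : X → Y → ℝ}
    (hrest : ∀ j, ∃ Q : DetProtocol (Player.other .alice) out k X Y Z,
      ∑ x, ∑ y, (if e x = j then G x y else 0) * Q.loss f lam x y ≤
        ∑ x, ∑ y, (if e x = j then G x y else 0) * D x y) :
    ∃ Q : DetProtocol .alice out (k + 1) X Y Z,
      ∑ x, ∑ y, G x y * Q.loss f lam x y ≤
        ∑ x, ∑ y, G x y * (lam * (code (e x)).length + D x y) := by
  have := Fintype.ofFinite J
  choose Q hQ using hrest
  have hsplit (H : J → X → Y → ℝ) : ∑ j, ∑ x, ∑ y, (if e x = j then G x y else 0) * H j x y =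
      ∑ x, ∑ y, G x y * H (e x) x y := by
    rw [Finset.sum_comm]
    refine Finset.sum_congr rfl fun x _ => ?_
    rw [Finset.sum_comm]
    simp
  have hsum := Finset.sum_le_sum fun j (_ : j ∈ Finset.univ) => hQ j
  rw [hsplit fun j => (Q j).loss f lam, hsplit fun _ => D] at hsum
  refine ⟨prependAlice code hcode e Q, ?_⟩
  have hloss (x : X) (y : Y) : (prependAlice code hcode e Q).loss f lam x y =
      lam * (code (e x)).length + (Q (e x)).loss f lam x y := by
    rw [loss, loss, prependAlice_answer, prependAlice_bits]
    push_cast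
    ring
  simp only [hloss, mul_add, Finset.sum_add_distrib]
  linarith

variable {M : Type*} {p : X → M → ℝ} {q : M → ℝ} {F : M → X → Y → ℝ}

lemma exists_loss_le_of_public_coins [Nonempty Z] (hG : ∀ x y, 0 ≤ G x y)
    (hrest : ∀ m (G' : X → Y → ℝ), (∀ x y, 0 ≤ G' x y) →
      (∀ x y, 0 < G' x y → 0 < G x y ∧ 0 < p x m) →
      ∃ Q : DetProtocol (Player.other .alice) out k X Y Z,
        ∑ x, ∑ y, G' x y * Q.loss f lam x y ≤ ∑ x, ∑ y, G' x y * F m x y)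
    {N : ℕ} (r : (Fin N → Option M) × (X → Option (Fin N)))
    (hr : ∀ x, (∃ y, 0 < G x y) → ∀ m, (r.2 x).bind r.1 = some m → 0 < p x m) :
    ∃ Q : DetProtocol .alice out (k + 1) X Y Z,
      ∑ x, ∑ y, G x y * Q.loss f lam x y ≤
        ∑ x, ∑ y, G x y * (lam * (indexCode (r.2 x)).length +
          ((r.2 x).bind r.1).elim 1 fun m => F m x y) := by
  classical
  refine exists_loss_le_of_code indexCode_prefix r.2 (D := fun x y =>
    ((r.2 x).bind r.1).elim 1 fun m => F m x y) fun j => ?_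
  have hG' (x : X) (y : Y) : 0 ≤ if r.2 x = j then G x y else 0 := by
    split_ifs
    exacts [hG x y, le_rfl]
  rcases hj : j.bind r.1 with _ | m
  · let z := Classical.arbitrary Z
    refine ⟨silent _ _ _ (fun _ => z) fun _ => z, Finset.sum_le_sum fun x _ =>
      Finset.sum_le_sum fun y _ => ?_⟩
    refine le_trans (mul_le_mul_of_nonneg_left (c := 1) ?_ (hG' x y)) (le_of_eq ?_)
    · rw [loss, silent_bits]
      split_ifs <;> simp
    · split_ifs with hx <;> simp [hx, hj]
  · obtain ⟨Q, hQ⟩ := hrest m (fun x y => if r.2 x = j then G x y else 0) hG' fun x y hxy => by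
      split_ifs at hxy with hx
      · exact ⟨hxy, hr x ⟨y, hxy⟩ m (hx ▸ hj)⟩
      · exact absurd hxy (lt_irrefl 0)
    refine ⟨Q, hQ.trans_eq (Finset.sum_congr rfl fun x _ => Finset.sum_congr rfl fun y _ => ?_)⟩
    split_ifs with hx <;> simp [hx, hj]

variable [Fintype M]

lemma sum_mul_elim_le [DecidableEq M] {R : Type*} [Fintype R] {w : R → ℝ} (o : R → Option M)
    {p F : M → ℝ} (hF : ∀ m, 0 ≤ F m) (hout : ∀ m, ∑ r, w r * (if o r = some m then 1 else 0) ≤ p m)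
    (hnone : ∑ r, w r * (if o r = none then 1 else 0) ≤ η) :
    ∑ r, w r * (o r).elim 1 F ≤ η + ∑ m, p m * F m := by
  have hsplit (r : R) : w r * (o r).elim 1 F = w r * (if o r = none then 1 else 0) +
      ∑ m, w r * (if o r = some m then 1 else 0) * F m := by
    cases o r <;> simp
  simp only [hsplit, Finset.sum_add_distrib]
  rw [Finset.sum_comm]
  simp only [← Finset.sum_mul]
  exact add_le_add hnone (Finset.sum_le_sum fun m _ => mul_le_mul_of_nonneg_right (hout m) (hF m))

/-- Compression of the first round: a message with distribution `p x` is replaced by its code of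
`exists_message_code_of_sum_le_one`, and finally the public coins are fixed. -/
lemma exists_loss_le_of_first_message [Nonempty Z] (hlam : 0 ≤ lam) (hη : 0 < η)
    (hG : ∀ x y, 0 ≤ G x y) (hF : ∀ m x y, 0 < G x y → 0 ≤ F m x y)
    (hp : ∀ x, (∃ y, 0 < G x y) → p x ∈ stdSimplex ℝ M) (hq0 : ∀ m, 0 ≤ q m) (hq1 : ∑ m, q m ≤ 1)
    (habs : ∀ x, (∃ y, 0 < G x y) → ∀ m, 0 < p x m → 0 < q m)
    (hrest : ∀ m (G' : X → Y → ℝ), (∀ x y, 0 ≤ G' x y) →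
      (∀ x y, 0 < G' x y → 0 < G x y ∧ 0 < p x m) →
      ∃ Q : DetProtocol (Player.other .alice) out k X Y Z,
        ∑ x, ∑ y, G' x y * Q.loss f lam x y ≤ ∑ x, ∑ y, G' x y * F m x y) :
    ∃ Q : DetProtocol .alice out (k + 1) X Y Z,
      ∑ x, ∑ y, G x y * Q.loss f lam x y ≤
        ∑ x, ∑ y, G x y * (∑ m, p x m * F m x y + lam * (4 * relEntropy (p x) q + 14) + η) := by
  classical
  obtain ⟨N, w, hw, hpos, hcode⟩ := exists_message_code_of_sum_le_one hp hq0 hq1 habs hη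
  let bound (r : (Fin N → Option M) × (X → Option (Fin N))) (x : X) (y : Y) : ℝ :=
    lam * (indexCode (r.2 x)).length + ((r.2 x).bind r.1).elim 1 fun m => F m x y
  have havg (x : X) (y : Y) (hxy : 0 < G x y) : ∑ r, w r * bound r x y ≤
      ∑ m, p x m * F m x y + lam * (4 * relEntropy (p x) q + 14) + η := by
    obtain ⟨hout, hnone, hlen⟩ := hcode x ⟨y, hxy⟩
    have helim := sum_mul_elim_le _ (hF · x y hxy) hout hnone
    have hlen' := mul_le_mul_of_nonneg_left hlen hlam
    simp only [bound, mul_add, Finset.sum_add_distrib, mul_left_comm (w _) lam, ← Finset.mul_sum]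
    linarith
  obtain ⟨r, hr, hle⟩ := exists_pos_weight_le hw fun r => ∑ x, ∑ y, G x y * bound r x y
  obtain ⟨Q, hQ⟩ := exists_loss_le_of_public_coins hG hrest r (hpos r hr)
  refine ⟨Q, hQ.trans (hle.trans ?_)⟩
  simp only [Finset.mul_sum, mul_left_comm (w _)]
  rw [Finset.sum_comm]
  refine Finset.sum_le_sum fun x _ => ?_
  rw [Finset.sum_comm]
  refine Finset.sum_le_sum fun y _ => ?_
  rw [← Finset.mul_sum]
  rcases (hG x y).eq_or_lt with hxy | hxy
  · simp [← hxy]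
  · exact mul_le_mul_of_nonneg_left (havg x y hxy) hxy.le

end OneRound

section FirstMessage

variable {out : Player} {k : ℕ} {X Y Z A B : Type*} {α : X → A → ℝ} {β : Y → B → ℝ}
  {q : History → ℝ} {x : X} {y : Y}

namespace DetProtocol

variable (P : DetProtocol .alice out (k + 1) (X × A) (Y × B) Z)

lemma restrict_pos_iff {m : List Bool} {a : A} :
    0 < P.restrict α m x a ↔ P.msgA [] (x, a) = m ∧ 0 < α x a := by
  unfold restrict
  split_ifs with hm <;> simp [hm]

lemma prior_cons_tail_pos
    (habs : ∀ a b, 0 < α x a → 0 < β y b → 0 < q (P.transcript (x, a) (y, b))) {m : List Bool}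
    {a : A} {b : B} (ha : 0 < P.restrict α m x a) (hb : 0 < β y b) :
    0 < q (m :: (P.tail m).transcript (x, a) (y, b)) := by
  obtain ⟨rfl, hαa⟩ := P.restrict_pos_iff.1 ha
  simpa only [← transcript_eq_msgA_cons] using habs a b hαa hb

variable [Fintype X] [Fintype A]

lemma firstMessageDist_mem_stdSimplex (hα : ∀ x a, 0 ≤ α x a) (hx : ∑ a, α x a ≠ 0) :
    P.firstMessageDist α x ∈ stdSimplex ℝ P.firstMessages := by
  refine ⟨fun m => div_nonneg (Finset.sum_nonneg fun a _ => P.restrict_nonneg hα m x a)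
    (Finset.sum_nonneg fun a _ => hα x a), ?_⟩
  simp only [firstMessageDist, ← Finset.sum_div]
  rw [Finset.sum_coe_sort P.firstMessages fun m => ∑ a, P.restrict α m x a, sum_total_restrict,
    div_self hx]

lemma firstMessagePrior_nonneg (hq : IsSemimeasure q) (m : P.firstMessages) :
    0 ≤ P.firstMessagePrior q m := div_nonneg (hq.nonneg _) (hq.nonneg _)

lemma sum_firstMessagePrior_le_one (hq : IsSemimeasure q) :
    ∑ m, P.firstMessagePrior q m ≤ 1 := by
  simp only [firstMessagePrior, ← Finset.sum_div]
  rw [Finset.sum_coe_sort P.firstMessages fun m => q [m]]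
  exact div_le_one_of_le₀ (hq.sum_le [] _) (hq.nonneg _)

lemma firstMessagePrior_pos (hα : ∀ x a, 0 ≤ α x a) (hq : IsSemimeasure q)
    (habs : ∀ a b, 0 < α x a → 0 < β y b → 0 < q (P.transcript (x, a) (y, b)))
    {b : B} (hb : 0 < β y b) {m : P.firstMessages} (hm : 0 < P.firstMessageDist α x m) :
    0 < P.firstMessagePrior q m := by
  obtain ⟨a, ha⟩ : ∃ a, 0 < P.restrict α m x a := by
    by_contra! hle
    exact hm.not_ge (div_nonpos_of_nonpos_of_nonneg (Finset.sum_nonpos fun a _ => hle a)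
      (Finset.sum_nonneg fun a _ => hα x a))
  have hpos := P.prior_cons_tail_pos habs ha hb
  exact div_pos (hpos.trans_le (hq.append_le [(m : List Bool)] _))
    (hpos.trans_le (hq.append_le [] _))

end DetProtocol

end FirstMessage

section Compression

variable {first out : Player} {k : ℕ} {X Y Z A B : Type*} [Fintype X] [Fintype A]
  [Fintype B] {f : X → Y → Z} {lam η : ℝ}

open DetProtocol

lemma coinMass_mul_sum_tail_le (P : DetProtocol .alice out (k + 1) (X × A) (Y × B) Z)
    {α : X → A → ℝ} {β : Y → B → ℝ} {q : History → ℝ} {x : X} {y : Y} (hlam : 0 ≤ lam) (hη : 0 ≤ η)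
    (hα : ∀ x a, 0 ≤ α x a) (hβ : ∀ y b, 0 ≤ β y b) (hq : IsSemimeasure q)
    (habs : ∀ a b, 0 < α x a → 0 < β y b → 0 < q (P.transcript (x, a) (y, b))) :
    coinMass α β x y * (∑ m : P.firstMessages, P.firstMessageDist α x m *
        ((P.tail m).simBound f (P.restrict α m) β (fun h => q (m :: h)) lam η x y /
          coinMass (P.restrict α m) β x y) +
      lam * (4 * relEntropy (P.firstMessageDist α x) (P.firstMessagePrior q) + 14) + η) ≤
    P.simBound f α β q lam η x y := by
  rw [P.simBound_eq_sum_tail hα hβ hq habs, add_assoc, mul_add, Finset.mul_sum,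
    ← Finset.sum_coe_sort P.firstMessages]
  gcongr with m
  rw [← mul_assoc, ← P.coinMass_restrict hα]
  rcases eq_or_ne (coinMass (P.restrict α m) β x y) 0 with hmass | hmass
  · rw [hmass, zero_mul]
    exact simBound_nonneg hlam hη (P.restrict_nonneg hα m) hβ (hq.cons m)
      fun a b ha hb => P.prior_cons_tail_pos habs ha hb
  · rw [mul_div_cancel₀ _ hmass]

variable [Fintype Y]

/-- The compressibility of the tail, in terms of the weight `G` of an input together with the first
message `m`, rather than of an input alone. -/
lemma Compressible.exists_tail (h : Compressible (Player.other .alice) out k A B f lam η)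
    (P : DetProtocol .alice out (k + 1) (X × A) (Y × B) Z) {α : X → A → ℝ} {β : Y → B → ℝ}
    {q : History → ℝ} (hα : ∀ x a, 0 ≤ α x a) (hβ : ∀ y b, 0 ≤ β y b) (hq : IsSemimeasure q)
    {m : List Bool} {G : X → Y → ℝ} (hG : ∀ x y, 0 ≤ G x y)
    (hmass : ∀ x y, 0 < G x y → coinMass (P.restrict α m) β x y ≠ 0)
    (habs : ∀ x y, 0 < G x y → ∀ a b, 0 < α x a → 0 < β y b →
      0 < q (P.transcript (x, a) (y, b))) :
    ∃ Q : DetProtocol (Player.other .alice) out k X Y Z,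
      ∑ x, ∑ y, G x y * Q.loss f lam x y ≤
        ∑ x, ∑ y, G x y * ((P.tail m).simBound f (P.restrict α m) β (fun h => q (m :: h)) lam η
          x y / coinMass (P.restrict α m) β x y) := by
  have hmass0 (x : X) (y : Y) := coinMass_nonneg (P.restrict_nonneg hα m) hβ x y
  obtain ⟨Q, hQ⟩ := h (P.tail m) (P.restrict α m) β (fun h => q (m :: h))
    (fun x y => G x y / coinMass (P.restrict α m) β x y) (P.restrict_nonneg hα m) hβ
    (fun x y => div_nonneg (hG x y) (hmass0 x y)) (hq.cons m) fun x y hxy a b ha hb =>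
      P.prior_cons_tail_pos (habs x y ((hG x y).lt_of_ne' (div_ne_zero_iff.1 hxy.ne').1)) ha hb
  refine ⟨Q, le_trans (le_of_eq ?_) (hQ.trans_eq ?_)⟩ <;>
    refine Finset.sum_congr rfl fun x _ => Finset.sum_congr rfl fun y _ => ?_
  · rcases (hG x y).eq_or_lt with hxy | hxy
    · simp [← hxy]
    · rw [div_mul_cancel₀ _ (hmass x y hxy)]
  · rw [div_mul_eq_mul_div, mul_div_assoc]

lemma compressible_succ_alice [Nonempty Z] (hlam : 0 ≤ lam) (hη : 0 < η)
    (h : Compressible (Player.other .alice) out k A B f lam η) :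
    Compressible .alice out (k + 1) A B f lam η := by
  intro P α β q g hα hβ hg hq habs
  have hmass0 := coinMass_nonneg hα hβ
  have hpos {x : X} {y : Y} (hxy : 0 < g x y * coinMass α β x y) :
      0 < g x y ∧ ∑ a, α x a ≠ 0 ∧ ∃ b, 0 < β y b := by
    obtain ⟨hgxy, hmass⟩ := mul_ne_zero_iff.1 hxy.ne'
    obtain ⟨hαx, hβy⟩ := mul_ne_zero_iff.1 hmass
    obtain ⟨b, -, hb⟩ := Finset.exists_ne_zero_of_sum_ne_zero hβy
    exact ⟨(hg x y).lt_of_ne' hgxy, hαx, b, (hβ y b).lt_of_ne' hb⟩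
  obtain ⟨Q, hQ⟩ := exists_loss_le_of_first_message (out := out) (k := k) (f := f)
    (G := fun x y => g x y * coinMass α β x y) (p := P.firstMessageDist α)
    (q := P.firstMessagePrior q) (F := fun m x y =>
      (P.tail m).simBound f (P.restrict α m) β (fun h => q (m :: h)) lam η x y /
        coinMass (P.restrict α m) β x y) hlam hη
    (fun x y => mul_nonneg (hg x y) (hmass0 x y))
    (fun m x y hxy => div_nonneg
      (simBound_nonneg hlam hη.le (P.restrict_nonneg hα m) hβ (hq.cons m) fun a b ha hb =>
        P.prior_cons_tail_pos (habs x y (hpos hxy).1) ha hb)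
      (coinMass_nonneg (P.restrict_nonneg hα m) hβ x y))
    (fun x ⟨y, hxy⟩ => P.firstMessageDist_mem_stdSimplex hα (hpos hxy).2.1)
    (P.firstMessagePrior_nonneg hq) (P.sum_firstMessagePrior_le_one hq)
    (fun x ⟨y, hxy⟩ m hm => by
      obtain ⟨hgxy, -, b, hb⟩ := hpos hxy
      exact P.firstMessagePrior_pos hα hq (habs x y hgxy) hb hm)
    (fun m G' hG' hG'pos => h.exists_tail P hα hβ hq hG'
      (fun x y hxy => by
        obtain ⟨hgxy, hm⟩ := hG'pos x y hxy
        rw [P.coinMass_restrict hα]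
        exact mul_ne_zero (right_ne_zero_of_mul hgxy.ne') hm.ne')
      (fun x y hxy => habs x y (hpos (hG'pos x y hxy).1).1))
  refine ⟨Q, hQ.trans (Finset.sum_le_sum fun x _ => Finset.sum_le_sum fun y _ => ?_)⟩
  rw [mul_assoc]
  rcases (hg x y).eq_or_lt with hxy | hxy
  · simp [← hxy]
  · exact mul_le_mul_of_nonneg_left
      (coinMass_mul_sum_tail_le P hlam hη.le hα hβ hq (habs x y hxy)) hxy.le

theorem compressible [Nonempty Z] (hlam : 0 ≤ lam) (hη : 0 < η) :
    Compressible first out k A B f lam η := by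
  induction k generalizing first out with
  | zero => exact compressible_zero
  | succ k ih =>
    cases first
    · exact compressible_succ_alice hlam hη ih
    · refine Compressible.swap (compressible_succ_alice hlam hη (Compressible.swap ?_))
      rw [Player.other_other]
      exact ih

end Compression

/-! ### Direct sum -/

/-- The random data of one party in the direct sum argument: a private coin with distribution
`coin`, and inputs with distribution `dist e`, where `e` is the index that makes the inputs of the
two parties independent. -/
structure PartySource (K X A : Type*) [Fintype X] [Fintype A] where
  dist : K → X → ℝ
  coin : A → ℝ
  dist_mem : ∀ e, dist e ∈ stdSimplex ℝ X
  coin_mem : coin ∈ stdSimplex ℝ A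

section SetInput

variable {ι X A : Type*} [DecidableEq ι]

/-- Replace the `i`-th input of a party whose private coin counts as part of its data. -/
def setInput (i : ι) (x : X) (p : (ι → X) × A) : (ι → X) × A := (Function.update p.1 i x, p.2)

lemma setInput_self (i : ι) (p : (ι → X) × A) : setInput i (p.1 i) p = p := by
  rw [setInput, Function.update_eq_self]

lemma setInput_apply (i : ι) (x : X) (p : (ι → X) × A) : (setInput i x p).1 i = x :=
  Function.update_self i _ p.1

lemma setInput_setInput (i : ι) (x x' : X) (p : (ι → X) × A) :
    setInput i x (setInput i x' p) = setInput i x p := by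
  simp only [setInput, Function.update_idem]

end SetInput

namespace PartySource

variable {ι K X Y A B : Type*} [Fintype ι] [Fintype X] [Fintype Y] [Fintype A] [Fintype B]
  (S : PartySource K X A) (T : PartySource K Y B) (d : ι → K)

/-- The probability of the inputs `p.1` and the coin `p.2`, when the `j`-th input has the
distribution `S.dist (d j)`. -/
def weight (p : (ι → X) × A) : ℝ := (∏ j, S.dist (d j) (p.1 j)) * S.coin p.2

lemma weight_nonneg (p : (ι → X) × A) : 0 ≤ S.weight d p :=
  mul_nonneg (Finset.prod_nonneg fun _ _ => (S.dist_mem _).1 _) (S.coin_mem.1 _)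

variable [DecidableEq ι]

/-- The expectation of `G` over the inputs and the coins of both parties. -/
def jointMean (G : (ι → X) × A → (ι → Y) × B → ℝ) : ℝ :=
  ∑ p, ∑ r, S.weight d p * T.weight d r * G p r

variable {G G' : (ι → X) × A → (ι → Y) × B → ℝ}

lemma jointMean_mono
    (h : ∀ p r, 0 < S.weight d p → 0 < T.weight d r → G p r ≤ G' p r) :
    S.jointMean T d G ≤ S.jointMean T d G' := by
  refine Finset.sum_le_sum fun p _ => Finset.sum_le_sum fun r _ => ?_
  rcases (S.weight_nonneg d p).eq_or_lt with hp | hp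
  · simp [← hp]
  rcases (T.weight_nonneg d r).eq_or_lt with hr | hr
  · simp [← hr]
  exact mul_le_mul_of_nonneg_left (h p r hp hr) (mul_pos hp hr).le

lemma jointMean_congr
    (h : ∀ p r, 0 < S.weight d p → 0 < T.weight d r → G p r = G' p r) :
    S.jointMean T d G = S.jointMean T d G' :=
  le_antisymm (S.jointMean_mono T d fun p r hp hr => (h p r hp hr).le)
    (S.jointMean_mono T d fun p r hp hr => (h p r hp hr).ge)

lemma jointMean_nonneg (h : ∀ p r, 0 ≤ G p r) : 0 ≤ S.jointMean T d G :=
  Finset.sum_nonneg fun p _ => Finset.sum_nonneg fun r _ =>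
    mul_nonneg (mul_nonneg (S.weight_nonneg d p) (T.weight_nonneg d r)) (h p r)

lemma weight_mul_le_jointMean (h : ∀ p r, 0 ≤ G p r) (p : (ι → X) × A) (r : (ι → Y) × B) :
    S.weight d p * T.weight d r * G p r ≤ S.jointMean T d G := by
  have hnonneg (p : (ι → X) × A) (r : (ι → Y) × B) : 0 ≤ S.weight d p * T.weight d r * G p r :=
    mul_nonneg (mul_nonneg (S.weight_nonneg d p) (T.weight_nonneg d r)) (h p r)
  exact (Finset.single_le_sum (fun r _ => hnonneg p r) (Finset.mem_univ r)).trans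
    (Finset.single_le_sum (f := fun p => ∑ r, S.weight d p * T.weight d r * G p r)
      (fun p _ => Finset.sum_nonneg fun r _ => hnonneg p r) (Finset.mem_univ p))

lemma jointMean_pos (h : ∀ p r, 0 ≤ G p r) {p : (ι → X) × A} {r : (ι → Y) × B}
    (hp : 0 < S.weight d p) (hr : 0 < T.weight d r) (hG : 0 < G p r) : 0 < S.jointMean T d G :=
  (mul_pos (mul_pos hp hr) hG).trans_le (S.weight_mul_le_jointMean T d h p r)

lemma jointMean_add :
    S.jointMean T d (fun p r => G p r + G' p r) = S.jointMean T d G + S.jointMean T d G' := by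
  simp only [jointMean, mul_add, Finset.sum_add_distrib]

lemma jointMean_sum {J : Type*} (s : Finset J) (F : J → (ι → X) × A → (ι → Y) × B → ℝ) :
    S.jointMean T d (fun p r => ∑ j ∈ s, F j p r) = ∑ j ∈ s, S.jointMean T d (F j) := by
  simp only [jointMean, Finset.mul_sum]
  rw [Finset.sum_comm]
  simp only [Finset.sum_comm (s := s)]
  rw [Finset.sum_comm]

lemma sum_weight : ∑ p, S.weight d p = 1 := by
  rw [Fintype.sum_prod_type]
  simp only [weight, ← Finset.mul_sum, S.coin_mem.2, mul_one]
  exact sum_prod_pi_eq_one fun j => (S.dist_mem (d j)).2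

lemma coinMass_weight (x : X) (y : Y) :
    coinMass (fun _ : X => S.weight d) (fun _ : Y => T.weight d) x y = 1 := by
  rw [coinMass, sum_weight, sum_weight, one_mul]

lemma jointMean_const (c : ℝ) : S.jointMean T d (fun _ _ => c) = c := by
  simp only [jointMean, ← Finset.mul_sum, ← Finset.sum_mul, sum_weight, one_mul]

lemma jointMean_le_of_coin_mean_le {c : ℝ}
    (h : ∀ u v, ∑ a, ∑ b, S.coin a * T.coin b * G (u, a) (v, b) ≤ c) :
    S.jointMean T d G ≤ c := by
  have hX : ∑ u : ι → X, ∏ j, S.dist (d j) (u j) = 1 :=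
    sum_prod_pi_eq_one fun j => (S.dist_mem (d j)).2
  have hY : ∑ v : ι → Y, ∏ j, T.dist (d j) (v j) = 1 :=
    sum_prod_pi_eq_one fun j => (T.dist_mem (d j)).2
  calc S.jointMean T d G
      = ∑ u : ι → X, ∑ v : ι → Y, (∏ j, S.dist (d j) (u j)) * (∏ j, T.dist (d j) (v j)) *
          ∑ a, ∑ b, S.coin a * T.coin b * G (u, a) (v, b) := by
        simp only [jointMean, Fintype.sum_prod_type, weight, Finset.mul_sum]
        refine Finset.sum_congr rfl fun u _ => ?_
        rw [Finset.sum_comm]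
        refine Finset.sum_congr rfl fun v _ => Finset.sum_congr rfl fun a _ =>
          Finset.sum_congr rfl fun b _ => ?_
        ring
    _ ≤ ∑ u : ι → X, ∑ v : ι → Y,
          (∏ j, S.dist (d j) (u j)) * (∏ j, T.dist (d j) (v j)) * c := by
        gcongr with u _ v _
        · exact mul_nonneg (Finset.prod_nonneg fun j _ => (S.dist_mem _).1 _)
            (Finset.prod_nonneg fun j _ => (T.dist_mem _).1 _)
        · exact h u v
    _ = c := by simp only [← Finset.sum_mul, ← Finset.mul_sum, hX, hY, one_mul]

lemma jointMean_logb_le {c : ℝ} (hpos : ∀ p r, 0 < S.weight d p → 0 < T.weight d r → 0 < G p r)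
    (hc : 0 < c) (h : S.jointMean T d G ≤ c) :
    S.jointMean T d (fun p r => Real.logb 2 (G p r)) ≤ Real.logb 2 c := by
  have hw (z : ((ι → X) × A) × ((ι → Y) × B)) : 0 ≤ S.weight d z.1 * T.weight d z.2 :=
    mul_nonneg (S.weight_nonneg d z.1) (T.weight_nonneg d z.2)
  have hdiv : S.jointMean T d (fun p r => G p r / c) ≤ S.jointMean T d (fun _ _ => 1) := by
    rw [jointMean_const]
    simpa only [jointMean, mul_div_assoc', ← Finset.sum_div] using div_le_one_of_le₀ h hc.le
  have hposdiv (z : ((ι → X) × A) × ((ι → Y) × B)) (hz : 0 < S.weight d z.1 * T.weight d z.2) :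
      0 < G z.1 z.2 / c :=
    div_pos (hpos z.1 z.2 (pos_of_mul_pos_left hz (T.weight_nonneg d z.2))
      (pos_of_mul_pos_right hz (S.weight_nonneg d z.1))) hc
  simp only [jointMean, ← Fintype.sum_prod_type', mul_one] at hdiv
  have hjensen := sum_mul_logb_nonpos one_lt_two hw hposdiv hdiv
  rw [Fintype.sum_prod_type'
    (f := fun p r => S.weight d p * T.weight d r * Real.logb 2 (G p r / c))] at hjensen
  have hsplit : S.jointMean T d (fun p r => Real.logb 2 (G p r)) =
      S.jointMean T d (fun p r => Real.logb 2 (G p r / c) + Real.logb 2 c) :=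
    S.jointMean_congr T d fun p r hp hr => by
      rw [Real.logb_div (hpos p r hp hr).ne' hc.ne', sub_add_cancel]
  rw [hsplit, jointMean_add, jointMean_const]
  exact add_le_of_nonpos_left hjensen

lemma jointMean_prod (φ : ι → X → Y → ℝ) :
    S.jointMean T d (fun p r => ∏ j, φ j (p.1 j) (r.1 j)) =
      ∏ j, ∑ x, ∑ y, S.dist (d j) x * T.dist (d j) y * φ j x y := by
  have hcoins (u : ι → X) (v : ι → Y) :
      ∑ a, ∑ b, S.weight d (u, a) * T.weight d (v, b) * ∏ j, φ j (u j) (v j) =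
        ∏ j, S.dist (d j) (u j) * T.dist (d j) (v j) * φ j (u j) (v j) := by
    simp only [weight, ← Finset.mul_sum, ← Finset.sum_mul, S.coin_mem.2, T.coin_mem.2, mul_one,
      Finset.prod_mul_distrib]
  simp only [← Fintype.sum_prod_type', jointMean]
  rw [Finset.prod_univ_sum, Fintype.piFinset_univ,
    ← (Equiv.arrowProdEquivProdArrow ι (fun _ => X) fun _ => Y).symm.sum_comp]
  simp only [Fintype.sum_prod_type, Equiv.arrowProdEquivProdArrow_symm_apply, ← hcoins]
  exact Finset.sum_congr rfl fun u _ => Finset.sum_comm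

lemma sum_weight_setInput (i : ι) (e : K) (F : (ι → X) × A → ℝ) :
    ∑ x, S.dist e x * ∑ p, S.weight d p * F (setInput i x p) =
      ∑ p, S.weight (Function.update d i e) p * F p := by
  have hupdate (j : ι) : S.dist (Function.update d i e j) =
      Function.update (fun j => S.dist (d j)) i (S.dist e) j :=
    Function.apply_update (fun _ => S.dist) d i e j
  have hresample := sum_prod_pi_resample (fun j => S.dist (d j)) i (S.dist_mem (d i)).2 (S.dist e)
    fun u => ∑ a, S.coin a * F (u, a)
  simp only [← hupdate, Finset.mul_sum] at hresample
  simp only [Fintype.sum_prod_type, weight, setInput, Finset.mul_sum, mul_assoc, ← hresample]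
  rw [Finset.sum_comm]
  refine Finset.sum_congr rfl fun u _ => Finset.sum_congr rfl fun x _ =>
    Finset.sum_congr rfl fun a _ => ?_
  ring

lemma jointMean_setInput (i : ι) (e : K) (G : (ι → X) × A → (ι → Y) × B → ℝ) :
    ∑ x, ∑ y, S.dist e x * T.dist e y *
        S.jointMean T d (fun p r => G (setInput i x p) (setInput i y r)) =
      S.jointMean T (Function.update d i e) G := by
  simp only [jointMean, mul_assoc, ← Finset.mul_sum]
  rw [← S.sum_weight_setInput d i e]
  simp only [← T.sum_weight_setInput d i e, Finset.mul_sum]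
  refine Finset.sum_congr rfl fun x _ => ?_
  rw [Finset.sum_comm]
  refine Finset.sum_congr rfl fun p _ => Finset.sum_congr rfl fun y _ =>
    Finset.sum_congr rfl fun r _ => ?_
  ring

lemma jointMean_update_setInput (i : ι) (e : K) (x : X) (y : Y)
    (G : (ι → X) × A → (ι → Y) × B → ℝ) :
    S.jointMean T (Function.update d i e) (fun p r => G (setInput i x p) (setInput i y r)) =
      S.jointMean T d (fun p r => G (setInput i x p) (setInput i y r)) := by
  rw [← jointMean_setInput]
  simp only [setInput_setInput, ← Finset.sum_mul, ← Finset.mul_sum, (S.dist_mem e).2,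
    (T.dist_mem e).2, one_mul]

/-- The distribution of a pair of inputs whose index has the distribution `κ`. -/
def mixture [Fintype K] (κ : K → ℝ) (x : X) (y : Y) : ℝ := ∑ e, κ e * (S.dist e x * T.dist e y)

variable [Fintype K] {κ : K → ℝ}

lemma mixture_nonneg (hκ : κ ∈ stdSimplex ℝ K) (x : X) (y : Y) : 0 ≤ S.mixture T κ x y :=
  Finset.sum_nonneg fun e _ =>
    mul_nonneg (hκ.1 e) (mul_nonneg ((S.dist_mem e).1 x) ((T.dist_mem e).1 y))

lemma sum_mixture_mul (H : X → Y → ℝ) : ∑ x, ∑ y, S.mixture T κ x y * H x y =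
    ∑ e, κ e * ∑ x, ∑ y, S.dist e x * T.dist e y * H x y := by
  simp only [mixture, Finset.sum_mul, Finset.mul_sum, mul_assoc]
  rw [Finset.sum_comm (s := (Finset.univ : Finset K))]
  exact Finset.sum_congr rfl fun x _ => Finset.sum_comm

lemma sum_mixture (hκ : κ ∈ stdSimplex ℝ K) : ∑ x, ∑ y, S.mixture T κ x y = 1 := by
  have h := S.sum_mixture_mul T (κ := κ) fun _ _ => 1
  simpa only [mul_one, ← Finset.sum_mul_sum, (S.dist_mem _).2, (T.dist_mem _).2, hκ.2] using h

lemma sum_mixture_mul_jointMean (i : ι) (G : (ι → X) × A → (ι → Y) × B → ℝ) :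
    ∑ x, ∑ y, S.mixture T κ x y *
        S.jointMean T d (fun p r => G (setInput i x p) (setInput i y r)) =
      ∑ e, κ e * S.jointMean T (Function.update d i e) G := by
  simp only [sum_mixture_mul, jointMean_setInput]

end PartySource

namespace DetProtocol

section Embed

variable {first out : Player} {k : ℕ} {ι X Y Z A B : Type*} [DecidableEq ι]

/-- Solve one instance of a problem with a protocol for several instances: the input is used as the
`i`-th instance, and the other instances come from the coins. -/
def embed (P : DetProtocol first out k ((ι → X) × A) ((ι → Y) × B) (ι → Z)) (i : ι) :
    DetProtocol first out k (X × ((ι → X) × A)) (Y × ((ι → Y) × B)) Z :=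
  P.comap (fun z => setInput i z.1 z.2) (fun z => setInput i z.1 z.2) fun z => z i

variable (P : DetProtocol first out k ((ι → X) × A) ((ι → Y) × B) (ι → Z)) (i : ι) (x : X) (y : Y)
  (p : (ι → X) × A) (r : (ι → Y) × B)

lemma embed_transcript : (P.embed i).transcript (x, p) (y, r) =
    P.transcript (setInput i x p) (setInput i y r) :=
  P.comap_transcript _ _ _ _ _

lemma embed_answer : (P.embed i).answer (x, p) (y, r) =
    P.answer (setInput i x p) (setInput i y r) i :=
  P.comap_answer _ _ _ _ _

end Embed

section CoordInfo

variable {first out : Player} {k : ℕ} {ι K X Y Z A B : Type*} [Fintype ι] [DecidableEq ι]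
  [Fintype X] [Fintype Y] [Fintype A] [Fintype B]
  (P : DetProtocol first out k ((ι → X) × A) ((ι → Y) × B) (ι → Z))
  (S : PartySource K X A) (T : PartySource K Y B) (d : ι → K)

/-- The distribution of the history, when the inputs are drawn according to `d`. -/
def prior (h : History) : ℝ :=
  S.jointMean T d fun p r => if P.history p r h.length = h then 1 else 0

/-- The probability of the transcript `t`, when the `i`-th inputs are `x` and `y`, and the other
inputs are drawn according to `d`. -/
def coordMass (i : ι) (x : X) (y : Y) (t : History) : ℝ :=
  S.jointMean T d fun p r => if P.transcript (setInput i x p) (setInput i y r) = t then 1 else 0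

/-- The mutual information, in bits, of the transcript and the `i`-th inputs, when the inputs are
drawn according to `d`. -/
def coordInfo (i : ι) : ℝ :=
  S.jointMean T d fun p r => Real.logb 2
    (P.coordMass S T d i (p.1 i) (r.1 i) (P.transcript p r) / P.prior S T d (P.transcript p r))

lemma embed_transMass (i : ι) (x : X) (y : Y) (t : History) :
    (P.embed i).transMass (fun _ => S.weight d) (fun _ => T.weight d) x y t =
      P.coordMass S T d i x y t := by
  simp only [transMass, coordMass, PartySource.jointMean, embed_transcript, mul_ite, mul_one,
    mul_zero]

lemma prior_of_length {t : History} (ht : t.length = k) :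
    P.prior S T d t = S.jointMean T d fun p r => if P.transcript p r = t then 1 else 0 := by
  rw [prior, ht]
  rfl

lemma sum_coordMass (i : ι) (e : K) {t : History} (ht : t.length = k) :
    ∑ x, ∑ y, S.dist e x * T.dist e y * P.coordMass S T d i x y t =
      P.prior S T (Function.update d i e) t := by
  rw [P.prior_of_length S T _ ht]
  exact S.jointMean_setInput T d i e fun p r => if P.transcript p r = t then 1 else 0

lemma coordMass_update (i : ι) (e : K) (x : X) (y : Y) (t : History) :
    P.coordMass S T (Function.update d i e) i x y t = P.coordMass S T d i x y t :=
  S.jointMean_update_setInput T d i e x y fun p r => if P.transcript p r = t then 1 else 0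

lemma prior_nonneg (h : History) : 0 ≤ P.prior S T d h :=
  S.jointMean_nonneg T d fun _ _ => ite_nonneg zero_le_one le_rfl

lemma coordMass_nonneg (i : ι) (x : X) (y : Y) (t : History) : 0 ≤ P.coordMass S T d i x y t :=
  S.jointMean_nonneg T d fun _ _ => ite_nonneg zero_le_one le_rfl

variable {d} in
lemma prior_transcript_pos {p : (ι → X) × A} {r : (ι → Y) × B} (hp : 0 < S.weight d p)
    (hr : 0 < T.weight d r) : 0 < P.prior S T d (P.transcript p r) := by
  rw [P.prior_of_length S T d (P.length_transcript p r)]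
  exact S.jointMean_pos T d (fun _ _ => ite_nonneg zero_le_one le_rfl) hp hr (by simp)

variable {d} in
lemma coordMass_setInput_pos {p : (ι → X) × A} {r : (ι → Y) × B} (hp : 0 < S.weight d p)
    (hr : 0 < T.weight d r) (i : ι) (x : X) (y : Y) :
    0 < P.coordMass S T d i x y (P.transcript (setInput i x p) (setInput i y r)) :=
  S.jointMean_pos T d (fun _ _ => ite_nonneg zero_le_one le_rfl) hp hr (by simp)

variable {d} in
lemma coordMass_transcript_pos {p : (ι → X) × A} {r : (ι → Y) × B} (hp : 0 < S.weight d p)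
    (hr : 0 < T.weight d r) (i : ι) :
    0 < P.coordMass S T d i (p.1 i) (r.1 i) (P.transcript p r) := by
  simpa only [setInput_self] using P.coordMass_setInput_pos S T hp hr i (p.1 i) (r.1 i)

lemma prior_nil : P.prior S T d [] = 1 := by
  simpa [prior, history] using S.jointMean_const T d 1

lemma isSemimeasure_prior : IsSemimeasure (P.prior S T d) where
  nonneg := P.prior_nonneg S T d
  sum_le h M := by
    simp only [prior]
    rw [← PartySource.jointMean_sum]
    refine S.jointMean_mono T d fun p r _ _ => ?_
    simp only [List.length_append, List.length_cons, List.length_nil, zero_add, history]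
    split_ifs with hph
    · simp only [hph, List.append_cancel_left_eq, List.cons.injEq, and_true, Finset.sum_ite_eq]
      split_ifs <;> norm_num
    · refine (Finset.sum_eq_zero fun m _ => if_neg fun hm => hph ?_).le
      exact (List.append_inj hm (P.length_history p r _)).1

lemma jointMean_prod_coordMass_div_prior_le_one {t : History} (ht : t.length = k) :
    S.jointMean T d (fun p r =>
      ∏ i, P.coordMass S T d i (p.1 i) (r.1 i) t / P.prior S T d t) ≤ 1 := by
  rw [S.jointMean_prod T d fun i x y => P.coordMass S T d i x y t / P.prior S T d t]
  have hfactor (i : ι) : ∑ x, ∑ y, S.dist (d i) x * T.dist (d i) y *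
      (P.coordMass S T d i x y t / P.prior S T d t) = P.prior S T d t / P.prior S T d t := by
    have hsum := P.sum_coordMass S T d i (d i) ht
    rw [Function.update_eq_self] at hsum
    simp only [← mul_div_assoc, ← Finset.sum_div, hsum]
  simp only [hfactor]
  exact Finset.prod_le_one (fun i _ => div_nonneg (P.prior_nonneg S T d t) (P.prior_nonneg S T d t))
    fun i _ => div_self_le_one _

lemma jointMean_prod_coordMass_div_prior_le :
    S.jointMean T d (fun p r => ∏ i, P.coordMass S T d i (p.1 i) (r.1 i) (P.transcript p r) /
      P.prior S T d (P.transcript p r)) ≤ 2 ^ P.cost := by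
  let ratio (t : History) (p : (ι → X) × A) (r : (ι → Y) × B) : ℝ :=
    ∏ i, P.coordMass S T d i (p.1 i) (r.1 i) t / P.prior S T d t
  let M : Finset History := Finset.univ.image
    fun z : ((ι → X) × A) × ((ι → Y) × B) => P.transcript z.1 z.2
  have hratio (t : History) (p : (ι → X) × A) (r : (ι → Y) × B) : 0 ≤ ratio t p r :=
    Finset.prod_nonneg fun i _ =>
      div_nonneg (P.coordMass_nonneg S T d i _ _ t) (P.prior_nonneg S T d t)
  calc S.jointMean T d (fun p r => ratio (P.transcript p r) p r)
      ≤ S.jointMean T d (fun p r => ∑ t ∈ M, ratio t p r) :=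
        S.jointMean_mono T d fun p r _ _ => Finset.single_le_sum (f := fun t => ratio t p r)
          (fun t _ => hratio t p r) (Finset.mem_image_of_mem _ (Finset.mem_univ (p, r)))
    _ = ∑ t ∈ M, S.jointMean T d (ratio t) := S.jointMean_sum T d M ratio
    _ ≤ ∑ _t ∈ M, 1 := Finset.sum_le_sum fun t ht => by
        obtain ⟨z, _, rfl⟩ := Finset.mem_image.1 ht
        exact P.jointMean_prod_coordMass_div_prior_le_one S T d (P.length_transcript _ _)
    _ = M.card := by simp
    _ ≤ 2 ^ P.cost := by exact_mod_cast P.card_transcripts_le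

/-- Since the coordinates of the inputs are independent given `d`, the ratios of the conditional and
the unconditional probabilities of the transcript can be multiplied. -/
theorem sum_coordInfo_le : ∑ i, P.coordInfo S T d i ≤ P.cost := by
  let ratio (p : (ι → X) × A) (r : (ι → Y) × B) (i : ι) : ℝ :=
    P.coordMass S T d i (p.1 i) (r.1 i) (P.transcript p r) / P.prior S T d (P.transcript p r)
  have hratio {p : (ι → X) × A} {r : (ι → Y) × B} (hp : 0 < S.weight d p)
      (hr : 0 < T.weight d r) (i : ι) : 0 < ratio p r i :=
    div_pos (P.coordMass_transcript_pos S T hp hr i) (P.prior_transcript_pos S T hp hr)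
  calc ∑ i, P.coordInfo S T d i
      = S.jointMean T d (fun p r => ∑ i, Real.logb 2 (ratio p r i)) :=
        (S.jointMean_sum T d _ fun i p r => Real.logb 2 (ratio p r i)).symm
    _ = S.jointMean T d (fun p r => Real.logb 2 (∏ i, ratio p r i)) :=
        S.jointMean_congr T d fun p r hp hr =>
          (Real.logb_prod _ _ fun i _ => (hratio hp hr i).ne').symm
    _ ≤ Real.logb 2 (2 ^ P.cost) :=
        S.jointMean_logb_le T d (fun p r hp hr => Finset.prod_pos fun i _ => hratio hp hr i)
          (by positivity) (P.jointMean_prod_coordMass_div_prior_le S T d)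
    _ = P.cost := by rw [Real.logb_pow, Real.logb_self_eq_one one_lt_two, mul_one]

end CoordInfo

end DetProtocol

namespace DetProtocol

variable {first out : Player} {k : ℕ} {ι K X Y Z A B : Type*} [Fintype ι] [DecidableEq ι]
  [Fintype X] [Fintype Y] [Fintype A] [Fintype B]
  (P : DetProtocol first out k ((ι → X) × A) ((ι → Y) × B) (ι → Z))
  (S : PartySource K X A) (T : PartySource K Y B) (i : ι) (d : ι → K)

lemma infoMass_embed {q : History → ℝ} (hq : q [] = 1) (x : X) (y : Y) :
    (P.embed i).infoMass (fun _ => S.weight d) (fun _ => T.weight d) q x y =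
      S.jointMean T d fun p r => Real.logb 2 (P.coordMass S T d i x y
        (P.transcript (setInput i x p) (setInput i y r)) /
          q (P.transcript (setInput i x p) (setInput i y r))) := by
  simp only [infoMass, PartySource.jointMean, embed_transMass, embed_transcript, hq,
    PartySource.coinMass_weight, div_one]

lemma embed_errMass_le {f : X → Y → Z} {δ : ℝ}
    (herr : ∀ u v,
      P.errMass (fun u v j => f (u j) (v j)) (fun _ => S.coin) (fun _ => T.coin) u v ≤ δ)
    (x : X) (y : Y) :
    (P.embed i).errMass f (fun _ => S.weight d) (fun _ => T.weight d) x y ≤ δ := by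
  classical
  have hmean : (P.embed i).errMass f (fun _ => S.weight d) (fun _ => T.weight d) x y =
      S.jointMean T d fun p r => if (P.embed i).answer (x, p) (y, r) ≠ f x y then 1 else 0 := by
    simp only [errMass, PartySource.jointMean, mul_ite, mul_one, mul_zero]
  rw [hmean]
  refine S.jointMean_le_of_coin_mean_le T d fun u v => (Finset.sum_le_sum fun a _ =>
    Finset.sum_le_sum fun b _ => ?_).trans (herr (Function.update u i x) (Function.update v i y))
  rw [embed_answer, setInput, setInput, mul_ite, mul_one, mul_zero]
  have hcoins : 0 ≤ S.coin a * T.coin b := mul_nonneg (S.coin_mem.1 a) (T.coin_mem.1 b)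
  split_ifs with hi hall hall
  · exact le_rfl
  · refine absurd ?_ hi
    simp only [not_not.1 hall, Function.update_self]
  · exact hcoins
  · exact le_rfl

variable [Fintype K] {κ : K → ℝ}

/-- The distribution of the history, when the `i`-th inputs are drawn according to a random index
with distribution `κ`, and the other ones according to `d`. -/
def mixedPrior (κ : K → ℝ) (h : History) : ℝ :=
  ∑ e, κ e * P.prior S T (Function.update d i e) h

lemma exists_coordInfo_le [Nonempty ι] (hκ : κ ∈ stdSimplex ℝ K) : ∃ i d,
    ∑ e, κ e * P.coordInfo S T (Function.update d i e) i ≤ P.cost / Fintype.card ι := by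
  let w (d : ι → K) : ℝ := ∏ j, κ (d j)
  have hw : w ∈ stdSimplex ℝ (ι → K) :=
    ⟨fun d => Finset.prod_nonneg fun j _ => hκ.1 _, sum_prod_pi_eq_one fun _ => hκ.2⟩
  have htotal : ∑ i, ∑ d, w d * P.coordInfo S T d i ≤ ∑ _i : ι, (P.cost : ℝ) / Fintype.card ι := by
    calc ∑ i, ∑ d, w d * P.coordInfo S T d i
        = ∑ d, w d * ∑ i, P.coordInfo S T d i := by
          rw [Finset.sum_comm]
          simp only [Finset.mul_sum]
      _ ≤ ∑ d, w d * P.cost := Finset.sum_le_sum fun d _ =>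
          mul_le_mul_of_nonneg_left (P.sum_coordInfo_le S T d) (hw.1 d)
      _ = ∑ _i : ι, (P.cost : ℝ) / Fintype.card ι := by
          rw [← Finset.sum_mul, hw.2, Finset.sum_const, Finset.card_univ, nsmul_eq_mul]
          field_simp
  obtain ⟨i, _, hi⟩ := Finset.exists_le_of_sum_le Finset.univ_nonempty htotal
  rw [← sum_prod_pi_update (fun _ => κ) i hκ.2] at hi
  obtain ⟨d, _, hd⟩ := exists_pos_weight_le hw fun d =>
    ∑ e, κ e * P.coordInfo S T (Function.update d i e) i
  exact ⟨i, d, hd.trans hi⟩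

lemma isSemimeasure_mixedPrior (hκ : κ ∈ stdSimplex ℝ K) :
    IsSemimeasure (P.mixedPrior S T i d κ) where
  nonneg h := Finset.sum_nonneg fun e _ => mul_nonneg (hκ.1 e) (P.prior_nonneg S T _ h)
  sum_le h M := by
    unfold mixedPrior
    rw [Finset.sum_comm]
    refine Finset.sum_le_sum fun e _ => ?_
    rw [← Finset.mul_sum]
    exact mul_le_mul_of_nonneg_left ((P.isSemimeasure_prior S T _).sum_le h M) (hκ.1 e)

lemma mixedPrior_nil (hκ : κ ∈ stdSimplex ℝ K) : P.mixedPrior S T i d κ [] = 1 := by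
  simp only [mixedPrior, prior_nil, mul_one, hκ.2]

lemma le_mixedPrior (hκ : κ ∈ stdSimplex ℝ K) (e : K) (h : History) :
    κ e * P.prior S T (Function.update d i e) h ≤ P.mixedPrior S T i d κ h :=
  Finset.single_le_sum (f := fun e => κ e * P.prior S T (Function.update d i e) h)
    (fun e _ => mul_nonneg (hκ.1 e) (P.prior_nonneg S T _ h)) (Finset.mem_univ e)

lemma mixedPrior_pos (hκ : κ ∈ stdSimplex ℝ K) {x : X} {y : Y}
    (hxy : 0 < S.mixture T κ x y) {p : (ι → X) × A} {r : (ι → Y) × B}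
    (hp : 0 < S.weight d p) (hr : 0 < T.weight d r) :
    0 < P.mixedPrior S T i d κ ((P.embed i).transcript (x, p) (y, r)) := by
  set t := (P.embed i).transcript (x, p) (y, r)
  have hmass : 0 < P.coordMass S T d i x y t := by
    simpa only [t, embed_transcript] using P.coordMass_setInput_pos S T hp hr i x y
  have hdist (e : K) (x : X) (y : Y) : 0 ≤ S.dist e x * T.dist e y :=
    mul_nonneg ((S.dist_mem e).1 x) ((T.dist_mem e).1 y)
  have hprior (e : K) : S.dist e x * T.dist e y * P.coordMass S T d i x y t ≤
      P.prior S T (Function.update d i e) t := by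
    have hterm (z : X × Y) : 0 ≤ S.dist e z.1 * T.dist e z.2 * P.coordMass S T d i z.1 z.2 t :=
      mul_nonneg (hdist e _ _) (P.coordMass_nonneg S T d i _ _ t)
    rw [← P.sum_coordMass S T d i e (P.embed i |>.length_transcript _ _),
      ← Fintype.sum_prod_type']
    exact Finset.single_le_sum (fun z _ => hterm z) (Finset.mem_univ (x, y))
  calc 0 < S.mixture T κ x y * P.coordMass S T d i x y t := mul_pos hxy hmass
    _ = ∑ e, κ e * (S.dist e x * T.dist e y * P.coordMass S T d i x y t) := by
        simp only [PartySource.mixture, Finset.sum_mul, mul_assoc]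
    _ ≤ P.mixedPrior S T i d κ t :=
        Finset.sum_le_sum fun e _ => mul_le_mul_of_nonneg_left (hprior e) (hκ.1 e)

lemma jointMean_logb_div_mixedPrior_le (hκ : κ ∈ stdSimplex ℝ K) {e : K} (he : 0 < κ e) :
    S.jointMean T (Function.update d i e) (fun p r => Real.logb 2
      (P.coordMass S T d i (p.1 i) (r.1 i) (P.transcript p r) /
        P.mixedPrior S T i d κ (P.transcript p r))) ≤
      P.coordInfo S T (Function.update d i e) i + -Real.logb 2 (κ e) := by
  rw [coordInfo, ← S.jointMean_const T (Function.update d i e) (-Real.logb 2 (κ e)),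
    ← PartySource.jointMean_add]
  refine S.jointMean_mono T _ fun p r hp hr => ?_
  have hmass := P.coordMass_transcript_pos S T hp hr i
  have hprior := P.prior_transcript_pos S T hp hr
  have hle := P.le_mixedPrior S T i d hκ e (P.transcript p r)
  have hmixed := (mul_pos he hprior).trans_le hle
  rw [coordMass_update] at hmass ⊢
  rw [Real.logb_div hmass.ne' hmixed.ne', Real.logb_div hmass.ne' hprior.ne']
  have hlog := Real.logb_le_logb_of_le one_lt_two (mul_pos he hprior) hle
  rw [Real.logb_mul he.ne' hprior.ne'] at hlog
  linarith

/-- Not knowing the index of the embedded instance costs at most its entropy. -/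
lemma sum_mixture_mul_infoMass_le (hκ : κ ∈ stdSimplex ℝ K) :
    ∑ x, ∑ y, S.mixture T κ x y *
      (P.embed i).infoMass (fun _ => S.weight d) (fun _ => T.weight d)
        (P.mixedPrior S T i d κ) x y ≤
    ∑ e, κ e * P.coordInfo S T (Function.update d i e) i + shannonEntropy κ := by
  have hresample := S.sum_mixture_mul_jointMean T d (κ := κ) i fun p r => Real.logb 2
    (P.coordMass S T d i (p.1 i) (r.1 i) (P.transcript p r) /
      P.mixedPrior S T i d κ (P.transcript p r))
  simp only [setInput_apply] at hresample
  simp only [P.infoMass_embed S T i d (P.mixedPrior_nil S T i d hκ), hresample]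
  rw [shannonEntropy, ← Finset.sum_neg_distrib, ← Finset.sum_add_distrib]
  refine Finset.sum_le_sum fun e _ => ?_
  rw [← mul_neg, ← mul_add]
  rcases (hκ.1 e).eq_or_lt with he | he
  · simp [← he]
  · exact mul_le_mul_of_nonneg_left (P.jointMean_logb_div_mixedPrior_le S T i d hκ he) he.le

lemma sum_mixture_mul_simBound_le (hκ : κ ∈ stdSimplex ℝ K) {f : X → Y → Z}
    {δ lam η : ℝ} (hlam : 0 ≤ lam)
    (herr : ∀ u v,
      P.errMass (fun u v j => f (u j) (v j)) (fun _ => S.coin) (fun _ => T.coin) u v ≤ δ) :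
    ∑ x, ∑ y, S.mixture T κ x y *
      (P.embed i).simBound f (fun _ => S.weight d) (fun _ => T.weight d)
        (P.mixedPrior S T i d κ) lam η x y ≤
    δ + lam * (4 * (∑ e, κ e * P.coordInfo S T (Function.update d i e) i + shannonEntropy κ) +
      14 * k) + k * η := by
  let info (x : X) (y : Y) : ℝ := (P.embed i).infoMass (fun _ => S.weight d) (fun _ => T.weight d)
    (P.mixedPrior S T i d κ) x y
  calc _ ≤ ∑ x, ∑ y, (S.mixture T κ x y * (δ + lam * (14 * k) + k * η) +
        lam * 4 * (S.mixture T κ x y * info x y)) := by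
        refine Finset.sum_le_sum fun x _ => Finset.sum_le_sum fun y _ => ?_
        have hmass := mul_le_mul_of_nonneg_left (P.embed_errMass_le S T i d herr x y)
          (S.mixture_nonneg T hκ x y)
        rw [simBound, PartySource.coinMass_weight]
        linarith
    _ = δ + lam * (14 * k) + k * η + lam * 4 * ∑ x, ∑ y, S.mixture T κ x y * info x y := by
        simp only [Finset.sum_add_distrib, ← Finset.mul_sum, ← Finset.sum_mul,
          S.sum_mixture T hκ, one_mul]
    _ ≤ δ + lam * (14 * k) + k * η + lam * 4 *
          (∑ e, κ e * P.coordInfo S T (Function.update d i e) i + shannonEntropy κ) := by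
        gcongr
        exact P.sum_mixture_mul_infoMass_le S T i d hκ
    _ = _ := by ring

theorem exists_single_instance [Nonempty ι] [Nonempty Z] (hκ : κ ∈ stdSimplex ℝ K)
    {f : X → Y → Z} {δ lam η : ℝ} (hlam : 0 ≤ lam) (hη : 0 < η)
    (herr : ∀ u v,
      P.errMass (fun u v j => f (u j) (v j)) (fun _ => S.coin) (fun _ => T.coin) u v ≤ δ) :
    ∃ Q : DetProtocol first out k X Y Z,
      ∑ x, ∑ y, S.mixture T κ x y * Q.loss f lam x y ≤
        δ + lam * (4 * (P.cost / Fintype.card ι + shannonEntropy κ) + 14 * k) + k * η := by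
  obtain ⟨i, d, hinfo⟩ := P.exists_coordInfo_le S T hκ
  obtain ⟨Q, hQ⟩ := compressible hlam hη (P.embed i) (fun _ => S.weight d) (fun _ => T.weight d)
    (P.mixedPrior S T i d κ) (S.mixture T κ) (fun _ => S.weight_nonneg d)
    (fun _ => T.weight_nonneg d) (S.mixture_nonneg T hκ) (P.isSemimeasure_mixedPrior S T i d hκ)
    fun x y hxy p r => P.mixedPrior_pos S T i d hκ hxy
  refine ⟨Q, ?_⟩
  simp only [PartySource.coinMass_weight, mul_one] at hQ
  refine hQ.trans ((P.sum_mixture_mul_simBound_le S T i d hκ hlam herr).trans ?_)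
  gcongr

end DetProtocol

/-! ### Complexity -/

lemma nonempty_of_mem_stdSimplex {K : Type*} [Fintype K] {κ : K → ℝ} (hκ : κ ∈ stdSimplex ℝ K) :
    Nonempty K := by
  by_contra hempty
  rw [not_nonempty_iff] at hempty
  simpa only [Finset.univ_eq_empty, Finset.sum_empty, zero_ne_one] using hκ.2

lemma shannonEntropy_nonneg {K : Type*} [Fintype K] {κ : K → ℝ} (hκ : κ ∈ stdSimplex ℝ K) :
    0 ≤ shannonEntropy κ := by
  refine neg_nonneg.2 (Finset.sum_nonpos fun e _ => ?_)
  exact mul_nonpos_of_nonneg_of_nonpos (hκ.1 e)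
    (Real.logb_nonpos one_lt_two (hκ.1 e) (mem_Icc_of_mem_stdSimplex hκ e).2)

namespace IsProductDist

variable {X Y : Type*} [Fintype X] [Fintype Y] {μ : X × Y → ℝ}

lemma mem_stdSimplex (h : IsProductDist μ) : μ ∈ stdSimplex ℝ (X × Y) := by
  obtain ⟨μX, hX, μY, hY, hμ⟩ := h
  refine ⟨fun p => (mul_nonneg (hX.1 p.1) (hY.1 p.2)).trans_eq (hμ p.1 p.2).symm, ?_⟩
  simp only [Fintype.sum_prod_type, hμ, ← Finset.sum_mul_sum, hX.2, hY.2, one_mul]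

lemma partitions (h : IsProductDist μ) : Partitions (fun _ : Unit => (1 : ℝ)) μ :=
  ⟨⟨fun _ => zero_le_one, by simp⟩, fun _ => μ, fun _ => h, fun p => by simp⟩

end IsProductDist

section Complexity

variable {first out : Player} {k m : ℕ} {X Y Z K : Type*}

open scoped Classical in
lemma PrivateCoinProtocol.HasError.errMass_le {P : PrivateCoinProtocol first out k X Y Z}
    {f : X → Y → Z} {δ : ℝ} (hP : P.HasError f δ) (x : X) (y : Y) :
    P.det.errMass f (fun _ => P.coinA) (fun _ => P.coinB) x y ≤ δ := by
  have hsum : (∑ a, ∑ b, if P.det.answer (x, a) (y, b) = f x y then P.coinA a * P.coinB b else 0) +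
      P.det.errMass f (fun _ => P.coinA) (fun _ => P.coinB) x y = 1 := by
    have hcoins : ∑ a, ∑ b, P.coinA a * P.coinB b = 1 := by
      rw [← Finset.sum_mul_sum, P.coinA_mem.2, P.coinB_mem.2, one_mul]
    simp only [DetProtocol.errMass, ← Finset.sum_add_distrib]
    refine (Finset.sum_congr rfl fun a _ => Finset.sum_congr rfl fun b _ => ?_).trans hcoins
    by_cases hab : P.det.answer (x, a) (y, b) = f x y <;> simp [hab]
  have := hP x y
  linarith

open scoped Classical in
lemma DetProtocol.truncate_error_le_loss (Q : DetProtocol first out k X Y Z) (f : X → Y → Z)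
    {b : ℝ} (hb : 0 < b) (x : X) (y : Y) :
    (if (Q.truncate ⌊b⌋₊).answer x y ≠ f x y then 1 else 0) ≤ Q.loss f (1 / b) x y := by
  rcases le_or_gt (Q.bits x y) ⌊b⌋₊ with hshort | hlong
  · rw [Q.truncate_answer hshort]
    exact le_add_of_nonneg_right (by positivity)
  · have hcut : 1 ≤ 1 / b * Q.bits x y := by
      rw [one_div_mul_eq_div, one_le_div₀ hb]
      exact ((Nat.floor_lt hb.le).1 hlong).le
    calc _ ≤ (1 : ℝ) := by split_ifs <;> norm_num
      _ ≤ 1 / b * Q.bits x y := hcut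
      _ ≤ _ := le_add_of_nonneg_left (by split_ifs <;> norm_num)

variable [Fintype X] [Fintype Y]

open scoped Classical in
lemma DetProtocol.hasDistError_iff (Q : DetProtocol first out k X Y Z) {f : X → Y → Z}
    {μ : X × Y → ℝ} (hμ : μ ∈ stdSimplex ℝ (X × Y)) {δ : ℝ} :
    Q.HasDistError f μ δ ↔
      ∑ x, ∑ y, μ (x, y) * (if Q.answer x y ≠ f x y then 1 else 0) ≤ δ := by
  have hsum : (∑ p : X × Y, if Q.answer p.1 p.2 = f p.1 p.2 then μ p else 0) +
      ∑ x, ∑ y, μ (x, y) * (if Q.answer x y ≠ f x y then 1 else 0) = 1 := by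
    refine Eq.trans ?_ hμ.2
    rw [← Fintype.sum_prod_type', ← Finset.sum_add_distrib]
    refine Finset.sum_congr rfl fun p _ => ?_
    by_cases hp : Q.answer p.1 p.2 = f p.1 p.2 <;> simp [hp]
  rw [DetProtocol.HasDistError, sub_le_iff_le_add]
  constructor <;> intro h <;> linarith

/-- Markov's inequality, applied to the number of bits. -/
lemma distComplexity_le_floor (Q : DetProtocol first out k X Y Z) {f : X → Y → Z} {μ : X × Y → ℝ}
    (hμ : μ ∈ stdSimplex ℝ (X × Y)) {b δ : ℝ} (hb : 0 < b)
    (hloss : ∑ x, ∑ y, μ (x, y) * Q.loss f (1 / b) x y ≤ δ) :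
    distComplexity first out k μ δ f ≤ (⌊b⌋₊ : ℕ∞) := by
  have herr : (Q.truncate ⌊b⌋₊).HasDistError f μ δ :=
    ((Q.truncate ⌊b⌋₊).hasDistError_iff hμ).2 <| hloss.trans' <|
      Finset.sum_le_sum fun x _ => Finset.sum_le_sum fun y _ =>
        mul_le_mul_of_nonneg_left (Q.truncate_error_le_loss f hb x y) (hμ.1 _)
  refine (iInf₂_le (Q.truncate ⌊b⌋₊) herr).trans ?_
  exact_mod_cast Finset.sup_le fun (p : X × Y) _ => Q.truncate_bits_le ⌊b⌋₊ p.1 p.2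

lemma distComplexity_le_floor_of_one_le [Nonempty Z] {f : X → Y → Z} {μ : X × Y → ℝ}
    (hμ : μ ∈ stdSimplex ℝ (X × Y)) {b δ : ℝ} (hb : 0 < b) (hδ : 1 ≤ δ) :
    distComplexity first out k μ δ f ≤ (⌊b⌋₊ : ℕ∞) := by
  obtain ⟨z⟩ := ‹Nonempty Z›
  refine distComplexity_le_floor (DetProtocol.silent first out k (fun _ => z) fun _ => z) hμ hb ?_
  refine le_trans ?_ (hμ.2.trans_le hδ)
  rw [Fintype.sum_prod_type]
  refine Finset.sum_le_sum fun x _ => Finset.sum_le_sum fun y _ => ?_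
  rw [DetProtocol.loss, DetProtocol.silent_bits, Nat.cast_zero, mul_zero, add_zero]
  exact mul_le_of_le_one_right (hμ.1 _) (by split_ifs <;> norm_num)

lemma loss_budget_le {a k ε : ℝ} (ha : 0 ≤ a) (hk : 1 ≤ k) (hε : 0 < ε) (hε' : ε ≤ 1 / 2) :
    1 / (2 * k / ε ^ 2 * (a + 2)) * (4 * a + 14 * k) + k * (ε / (4 * k)) ≤ 2 * ε := by
  have hk0 : 0 < k := one_pos.trans_le hk
  have hcomm : 1 / (2 * k / ε ^ 2 * (a + 2)) * (4 * a + 14 * k) ≤ 7 / 2 * ε ^ 2 := by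
    rw [one_div_mul_eq_div, div_le_iff₀ (by positivity)]
    calc 4 * a + 14 * k ≤ 7 * k * (a + 2) := by nlinarith
      _ = 7 / 2 * ε ^ 2 * (2 * k / ε ^ 2 * (a + 2)) := by field_simp
  have hquarter : k * (ε / (4 * k)) = ε / 4 := by field_simp
  nlinarith

theorem distComplexity_le_floor_of_protocol [Fintype K]
    (P : PrivateCoinProtocol first out k (Fin m → X) (Fin m → Y) (Fin m → Z)) {f : X → Y → Z}
    {ε δ : ℝ} (hm : 0 < m) (hk : 0 < k) (hε : 0 < ε) (hδ : 0 ≤ δ) (hP : P.HasError (copies f m) δ)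
    {μ : X × Y → ℝ} (hμ : μ ∈ stdSimplex ℝ (X × Y)) {κ : K → ℝ} (hκμ : Partitions κ μ) :
    distComplexity first out k μ (δ + 2 * ε) f ≤
      (⌊2 * k / ε ^ 2 * (P.cost / m + shannonEntropy κ + 2)⌋₊ : ℕ∞) := by
  obtain ⟨hκ, ν, hν, hμν⟩ := hκμ
  choose νX hX νY hY hνXY using hν
  obtain ⟨x₀, y₀⟩ := nonempty_of_mem_stdSimplex hμ
  have : Nonempty Z := ⟨f x₀ y₀⟩
  have : NeZero m := ⟨hm.ne'⟩
  have hH := shannonEntropy_nonneg hκ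
  rcases lt_or_ge (1 / 2) ε with hlarge | hsmall
  · exact distComplexity_le_floor_of_one_le hμ (by positivity) (by linarith)
  let S : PartySource K X (Fin P.nA) := ⟨νX, P.coinA, hX, P.coinA_mem⟩
  let T : PartySource K Y (Fin P.nB) := ⟨νY, P.coinB, hY, P.coinB_mem⟩
  obtain ⟨Q, hQ⟩ := P.det.exists_single_instance S T hκ
    (lam := 1 / (2 * k / ε ^ 2 * (P.cost / m + shannonEntropy κ + 2))) (η := ε / (4 * k))
    (by positivity) (by positivity) hP.errMass_le
  have hmix (x : X) (y : Y) : μ (x, y) = S.mixture T κ x y := by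
    simp only [hμν, hνXY, PartySource.mixture, S, T]
  refine distComplexity_le_floor Q hμ (by positivity) ?_
  simp only [hmix]
  have hbudget := loss_budget_le (a := P.cost / m + shannonEntropy κ) (by positivity)
    (Nat.one_le_cast.2 hk) hε hsmall
  rw [Fintype.card_fin, ← PrivateCoinProtocol.cost] at hQ
  linarith

end Complexity

lemma exists_cost_eq_randComplexity {first out : Player} {k : ℕ} {X Y Z : Type*} [Fintype X]
    [Fintype Y] {f : X → Y → Z} {δ : ℝ} (h : randComplexity first out k δ f ≠ ⊤) :
    ∃ P : PrivateCoinProtocol first out k X Y Z,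
      P.HasError f δ ∧ (P.cost : ℕ∞) = randComplexity first out k δ f := by
  rw [randComplexity, iInf_subtype'] at h ⊢
  have : Nonempty {P : PrivateCoinProtocol first out k X Y Z // P.HasError f δ} := by
    by_contra hempty
    rw [not_nonempty_iff] at hempty
    exact h (iInf_of_empty _)
  obtain ⟨⟨P, hP⟩, hcost⟩ := ENat.exists_eq_iInf
    fun P : {P : PrivateCoinProtocol first out k X Y Z // P.HasError f δ} => (P.1.cost : ℕ∞)
  exact ⟨P, hP, hcost⟩

lemma complexityToEReal_natCast (n : ℕ) : complexityToEReal n = ((n : ℝ) : EReal) := by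
  simp only [complexityToEReal]
  norm_cast

lemma complexityToEReal_top : complexityToEReal ⊤ = ⊤ := by
  simp [complexityToEReal]

lemma mul_complexityToEReal_sub_le {m k n : ℕ} (hm : 0 < m) (hk : 0 < k) {ε H : ℝ} (hε : 0 < ε)
    (hH : 0 ≤ H) {D : ℕ∞} (hD : D ≤ (⌊2 * k / ε ^ 2 * ((n : ℝ) / m + H + 2)⌋₊ : ℕ∞)) :
    (m : EReal) * (((ε ^ 2 / (2 * k) : ℝ) : EReal) * complexityToEReal D - 2 - (H : EReal)) ≤
      complexityToEReal n := by
  obtain ⟨j, rfl⟩ := ENat.ne_top_iff_exists.1 (ne_top_of_le_ne_top (ENat.natCast_ne_top _) hD)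
  have hj : (j : ℝ) ≤ 2 * k / ε ^ 2 * ((n : ℝ) / m + H + 2) :=
    (Nat.le_floor_iff (by positivity)).1 (by exact_mod_cast hD)
  have hreal : (m : ℝ) * (ε ^ 2 / (2 * k) * j - 2 - H) ≤ n := by
    have hscaled : ε ^ 2 / (2 * k) * j ≤ (n : ℝ) / m + H + 2 :=
      (mul_le_mul_of_nonneg_left hj (by positivity)).trans_eq (by field_simp)
    calc (m : ℝ) * (ε ^ 2 / (2 * k) * j - 2 - H) ≤ m * ((n : ℝ) / m) := by
          gcongr
          linarith
      _ = n := by field_simp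
  rw [complexityToEReal_natCast, complexityToEReal_natCast]
  rw [← EReal.coe_coe_eq_natCast m, show (2 : EReal) = ((2 : ℝ) : EReal) from rfl,
    ← EReal.coe_mul, ← EReal.coe_sub, ← EReal.coe_sub, ← EReal.coe_mul]
  exact EReal.coe_le_coe_iff.2 hreal

end

theorem mainTheorem2 {X Y Z : Type*} [Fintype X] [Fintype Y] (f : X → Y → Z)
    (first out : Player) (m k : ℕ) (hm : 0 < m) (hk : 0 < k)
    (ε δ : ℝ) (hε : 0 < ε) (hδ : 0 < δ) :
    (∀ (μ : X × Y → ℝ) (_ : μ ∈ stdSimplex ℝ (X × Y)) (K : Type*) (_ : Fintype K) (κ : K → ℝ)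
        (_ : Partitions κ μ),
      (m : EReal) *
          (((ε ^ 2 / (2 * k) : ℝ) : EReal) *
              complexityToEReal (distComplexity first out k μ (δ + 2 * ε) f)
            - 2 - ((shannonEntropy κ : ℝ) : EReal))
        ≤ complexityToEReal (randComplexity first out k δ (copies f m))) ∧
    (m : EReal) *
        (((ε ^ 2 / (2 * k) : ℝ) : EReal) *
            complexityToEReal (productComplexity first out k (δ + 2 * ε) f) - 2)
      ≤ complexityToEReal (randComplexity first out k δ (copies f m)) := by
  by_cases htop : randComplexity first out k δ (copies f m) = ⊤
  · rw [htop, complexityToEReal_top]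
    exact ⟨fun _ _ _ _ _ _ => le_top, le_top⟩
  obtain ⟨P, hP, hcost⟩ := exists_cost_eq_randComplexity htop
  rw [← hcost]
  refine ⟨fun μ hμ K _ κ hκ => mul_complexityToEReal_sub_le hm hk hε (shannonEntropy_nonneg hκ.1)
    (distComplexity_le_floor_of_protocol P hm hk hε hδ.le hP hμ hκ), ?_⟩
  have hentropy : shannonEntropy (fun _ : Unit => (1 : ℝ)) = 0 := by simp [shannonEntropy]
  have hproduct : productComplexity first out k (δ + 2 * ε) f ≤
      (⌊2 * k / ε ^ 2 * ((P.cost : ℝ) / m + 0 + 2)⌋₊ : ℕ∞) := iSup₂_le fun μ hμ => hentropy ▸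
    distComplexity_le_floor_of_protocol P hm hk hε hδ.le hP hμ.mem_stdSimplex hμ.partitions
  simpa only [EReal.coe_zero, sub_zero] using
    mul_complexityToEReal_sub_le hm hk hε le_rfl hproduct
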